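/- For a prime $p$ and an integer $\ell\ge 1$ let $\mathcal C_\ell$ be the class of functions $f_a:\mathbb F_p^\ell\to\{\pm1\}$, $a\in\mathbb F_p^\ell$, where $f_a(z)=+1$ if $z_\ell=a_1z_1+\dots+a_{\ell-1}z_{\ell-1}+a_\ell$ and $f_a(z)=-1$ otherwise. For a distribution $D$ on a set $X$, an oracle $\mathsf{STAT}^{(k)}_D(\tau)$ answers every query $\phi:X^k\to[-1,1]$ with some $v$ such that $|v-\mathbb E_{x\sim D^k}[\phi(x)]|\le\tau$. A $k$-wise SQ algorithm adaptively asks such queries and then outputs a hypothesis. It learns a class $\mathcal C$ of functions $Z\to\{\pm1\}$ distribution-independently with error $\epsilon$ and failure probability $\delta$ from $\mathsf{STAT}^{(k)}(\tau)$ if for every distribution $P$ on $Z$, every $f\in\mathcal C$ and every oracle $\mathsf{STAT}^{(k)}_{P^f}(\tau)$, where $P^f$ is the distribution of $(z,f(z))$ with $z\sim P$, it outputs, with probability at least $1-\delta$ over its own randomness, a hypothesis $h$ with $\Pr_{z\sim P}[h(z)\ne f(z)]\le\epsilon$. The $k$-wise SQ complexity of learning $\mathcal C$ with error $\epsilon$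 and failure probability $\delta$ is the smallest $m\ge1$ such that some possibly randomized algorithm does so with at most $m$ queries to $\mathsf{STAT}^{(k)}(1/m)$. 1. (Upper bound.) For every $k\ge1$ there is a constant $c=c(k)>0$ such that for every prime $p$ there is a positive integer $t\le c\log p$ such that for every $\epsilon>0$ some deterministic algorithm learns $\mathcal C_{k+1}$ distribution-independently with error $\epsilon$ using at most $t$ queries to $\mathsf{STAT}^{(k+1)}(\epsilon^{k+1}/t)$. 2. (Lower bound.) For every $\delta\in[0,1)$ there is a constant $c=c(\delta)>0$ such that for all primes $p$ and all integers $k\ge1$ and $\ell\ge k+1$ there is a real $t\ge c\,p^{(\ell-k)/4}$ such that every possibly randomized algorithm that learns $\mathcal C_\ell$ distribution-independently with error $1/2-2/t$ and failure probability $\delta$ from $\mathsf{STAT}^{(k)}(1/t)$ needs at least $t$ queries. 3. (Separation.) For all $k\ge1$, $\epsilon\in(0,1/2)$ and $\delta\in[0,1)$ there are constants $c_1,c_2>0$, depending only on $k,\epsilon,\delta$, such that for every prime $p$ the $(k+1)$-wise SQ complexity of learning $\mathcal C_{k+1}$ with error $\epsilon$ and failure probability $\delta$ is at most $c_1\log p$,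 whereas its $k$-wise SQ complexity is at least $c_2\,p^{1/4}$. -/

import Mathlib

open scoped ENNReal

noncomputable section

namespace KWiseSQ

/-- The expectation `D^k[φ]` of `φ` over `k` i.i.d. draws from `D`, for a finite domain. -/
def expect {X : Type} [Fintype X] {k : ℕ} (D : PMF X) (φ : (Fin k → X) → ℝ) : ℝ :=
  ∑ x : Fin k → X, (∏ i, (D (x i)).toReal) * φ x

/-- A `k`-wise statistical query over the domain `X`: a function `X^k → [-1, 1]`. -/
abbrev Query (k : ℕ) (X : Type) : Type := (Fin k → X) → Set.Icc (-1 : ℝ) 1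

/-- `O` is a `k`-wise statistical query oracle for `D` of tolerance `τ`. -/
def IsSTAT {X : Type} [Fintype X] {k : ℕ} (D : PMF X) (τ : ℝ) (O : Query k X → ℝ) : Prop :=
  ∀ φ : Query k X, |O φ - expect D (fun x => (φ x : ℝ))| ≤ τ

/-- A deterministic adaptive `k`-wise SQ algorithm over samples in `X` with outputs in `H`:
it either stops with an output, or asks a query and continues depending on the answer. -/
inductive SQAlg (k : ℕ) (X H : Type) : Type
  | output (h : H) : SQAlg k X H
  | query (φ : Query k X) (next : ℝ → SQAlg k X H) : SQAlg k X H

/-- The output of an SQ algorithm when its queries are answered by `O`. -/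
def SQAlg.run {k : ℕ} {X H : Type} (O : Query k X → ℝ) : SQAlg k X H → H
  | .output h => h
  | .query φ next => (next (O φ)).run O

/-- The number of queries an SQ algorithm asks when its queries are answered by `O`. -/
def SQAlg.numQueries {k : ℕ} {X H : Type} (O : Query k X → ℝ) : SQAlg k X H → ℕ
  | .output _ => 0
  | .query φ next => (next (O φ)).numQueries O + 1

/-- The distribution `P^f` of the labeled example `(z, f z)` with `z ∼ P`; labels are `±1`. -/
def labeled {Z : Type} (P : PMF Z) (f : Z → ℤˣ) : PMF (Z × ℤˣ) :=
  P.map fun z => (z, f z)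

/-- The error `Pr_{z ∼ P}[h z ≠ f z]` of the hypothesis `h`. -/
def err {Z : Type} [Fintype Z] (P : PMF Z) (f h : Z → ℤˣ) : ℝ :=
  ∑ z with h z ≠ f z, (P z).toReal

/-- Distribution-independent PAC learnability of `C` with error at most `ε` by a deterministic
algorithm asking at most `q` queries to a `k`-wise SQ oracle of tolerance `τ`. -/
def DetLearnable {Z : Type} [Fintype Z] (k : ℕ) (C : Set (Z → ℤˣ)) (ε τ : ℝ) (q : ℕ) : Prop :=
  ∃ A : SQAlg k (Z × ℤˣ) (Z → ℤˣ),
    ∀ (P : PMF Z), ∀ f ∈ C, ∀ O : Query k (Z × ℤˣ) → ℝ, IsSTAT (labeled P f) τ O →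
      A.numQueries O ≤ q ∧ err P f (A.run O) ≤ ε

/-- Distribution-independent PAC learnability of `C` with error at most `ε` and failure
probability at most `δ` by a randomized algorithm asking at most `q` queries to a `k`-wise SQ
oracle of tolerance `τ`. A randomized algorithm is a deterministic one depending on a random
seed `ω`. The failure event is measured by the outer measure, so that no measurability of the
family `A` has to be assumed. -/
def RandLearnable {Z : Type} [Fintype Z] (k : ℕ) (C : Set (Z → ℤˣ)) (ε δ τ : ℝ) (q : ℕ) :
    Prop :=
  ∃ (Ω : Type) (_ : MeasurableSpace Ω) (μ : MeasureTheory.Measure Ω)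
    (_ : MeasureTheory.IsProbabilityMeasure μ) (A : Ω → SQAlg k (Z × ℤˣ) (Z → ℤˣ)),
    ∀ (P : PMF Z), ∀ f ∈ C, ∀ O : Query k (Z × ℤˣ) → ℝ, IsSTAT (labeled P f) τ O →
      (∀ ω, (A ω).numQueries O ≤ q) ∧
        μ {ω | ε < err P f ((A ω).run O)} ≤ ENNReal.ofReal δ

/-- The `k`-wise SQ complexity of PAC learning `C` with error `ε` and failure probability `δ`:
the smallest positive `m` such that `m` queries of tolerance `1/m` suffice (`⊤` if none does). -/
def sqComplexity {Z : Type} [Fintype Z] (k : ℕ) (C : Set (Z → ℤˣ)) (ε δ : ℝ) : ℕ∞ :=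
  ⨅ (m : ℕ) (_ : 0 < m ∧ RandLearnable k C ε δ (1 / (m : ℝ)) m), (m : ℕ∞)

/-- The affine hyperplane `z_ℓ = a_1 z_1 + ⋯ + a_{ℓ-1} z_{ℓ-1} + a_ℓ` of `𝔽_p^ℓ`, `ℓ = n + 1`. -/
def hyp {p n : ℕ} (a : Fin (n + 1) → ZMod p) : Set (Fin (n + 1) → ZMod p) :=
  {z | z (Fin.last n) = ∑ i : Fin n, a i.castSucc * z i.castSucc + a (Fin.last n)}

open Classical in
/-- The `±1` indicator of `hyp a`. -/
def hypFun {p n : ℕ} (a : Fin (n + 1) → ZMod p) : (Fin (n + 1) → ZMod p) → ℤˣ :=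
  fun z => if z ∈ hyp a then 1 else -1

/-- The concept class `C_ℓ` of `±1` indicators of hyperplanes in `𝔽_p^ℓ`, where `ℓ = n + 1`. -/
def hypClass (p n : ℕ) : Set ((Fin (n + 1) → ZMod p) → ℤˣ) :=
  Set.range hypFun

end KWiseSQ

end

noncomputable section

namespace KWiseSQ

section IndependentTuples

variable (K : Type) {V Z : Type} [Field K] [AddCommGroup V] [Module K V]
  (u : Z → V) (w : Z → ℝ)

/-- The span of the vectors attached to a tuple. -/
def tupleSpan {j : ℕ} (x : Fin j → Z) : Submodule K V :=
  Submodule.span K (Set.range (u ∘ x))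

open Classical in
/-- The product weight of a tuple whose vectors are linearly independent, and zero otherwise. -/
def indepWeight {j : ℕ} (x : Fin j → Z) : ℝ :=
  if LinearIndependent K (u ∘ x) then ∏ i, w (x i) else 0

variable {K u w} in
lemma indepWeight_nonneg (hw : ∀ z, 0 ≤ w z) {j : ℕ} (x : Fin j → Z) :
    0 ≤ indepWeight K u w x := by
  unfold indepWeight
  split_ifs
  · exact Finset.prod_nonneg fun i _ => hw _
  · exact le_rfl

variable {K u w} in
open Classical in
lemma indepWeight_cons {j : ℕ} (z : Z) (x : Fin j → Z) :
    indepWeight K u w (Fin.cons z x : Fin (j + 1) → Z) =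
      indepWeight K u w x * (if u z ∈ tupleSpan K u x then 0 else w z) := by
  have h : u ∘ (Fin.cons z x : Fin (j + 1) → Z) = Fin.cons (u z) (u ∘ x) := by
    funext i
    refine Fin.cases ?_ (fun i => ?_) i <;> simp
  unfold indepWeight tupleSpan
  rw [h, linearIndependent_finCons, Fin.prod_univ_succ]
  by_cases h1 : LinearIndependent K (u ∘ x) <;>
    by_cases h2 : u z ∈ Submodule.span K (Set.range (u ∘ x)) <;> simp [h1, h2, mul_comm]

variable [Fintype Z]

/-- The total product weight of all linearly independent `j`-tuples. -/
def indepMass (j : ℕ) : ℝ :=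
  ∑ x : Fin j → Z, indepWeight K u w x

variable {K} in
open Classical in
/-- The weight of the points whose vectors lie outside `U`. -/
def massOff (U : Submodule K V) : ℝ :=
  ∑ z : Z, if u z ∈ U then 0 else w z

variable {K u w}

lemma indepMass_nonneg (hw : ∀ z, 0 ≤ w z) (j : ℕ) : 0 ≤ indepMass K u w j :=
  Finset.sum_nonneg fun x _ => indepWeight_nonneg hw x

lemma indepMass_zero : indepMass K u w 0 = 1 := by
  simp [indepMass, indepWeight]

lemma massOff_nonneg (hw : ∀ z, 0 ≤ w z) (U : Submodule K V) : 0 ≤ massOff u w U :=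
  Finset.sum_nonneg fun z _ => by split_ifs <;> simp [hw]

lemma indepMass_succ (j : ℕ) :
    indepMass K u w (j + 1) =
      ∑ x : Fin j → Z, indepWeight K u w x * massOff u w (tupleSpan K u x) := by
  classical
  unfold indepMass massOff
  rw [← (Fin.consEquiv fun _ => Z).sum_comp, Fintype.sum_prod_type_right]
  refine Finset.sum_congr rfl fun x _ => ?_
  rw [Finset.mul_sum]
  refine Finset.sum_congr rfl fun z _ => ?_
  rw [← indepWeight_cons]
  rfl

/-- If `U` has dimension at most `d`, every independent `(d+1)`-tuple has a member outside `U`. -/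
lemma indepMass_succ_le [FiniteDimensional K V] (hw : ∀ z, 0 ≤ w z) (U : Submodule K V) {d : ℕ}
    (hU : Module.finrank K U ≤ d) :
    indepMass K u w (d + 1) ≤ (d + 1) * massOff u w U * indepMass K u w d := by
  classical
  have key : ∀ x : Fin (d + 1) → Z, indepWeight K u w x ≤
      ∑ i : Fin (d + 1), (if u (x i) ∈ U then 0 else w (x i)) *
        indepWeight K u w (fun m => x (i.succAbove m)) := by
    intro x
    have hn : ∀ i : Fin (d + 1), 0 ≤ (if u (x i) ∈ U then 0 else w (x i)) *
        indepWeight K u w (fun m => x (i.succAbove m)) := fun i =>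
      mul_nonneg (by split_ifs <;> simp [hw]) (indepWeight_nonneg hw _)
    by_cases hx : LinearIndependent K (u ∘ x)
    · obtain ⟨i, hi⟩ : ∃ i, u (x i) ∉ U := by
        by_contra! hall
        have h1 : tupleSpan K u x ≤ U := by
          refine Submodule.span_le.2 ?_
          rintro _ ⟨i, rfl⟩
          exact hall i
        have h2 := Submodule.finrank_mono h1
        have h3 : Module.finrank K (tupleSpan K u x) = d + 1 := by
          exact (finrank_span_eq_card hx).trans (Fintype.card_fin _)
        omega
      refine le_trans (le_of_eq ?_)
        (Finset.single_le_sum (fun i _ => hn i) (Finset.mem_univ i))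
      have hx' : LinearIndependent K (u ∘ fun m => x (i.succAbove m)) :=
        hx.comp _ Fin.succAbove_right_injective
      simp only [indepWeight, hx, hx', hi, if_true, if_false]
      exact Fin.prod_univ_succAbove _ i
    · simp only [indepWeight, hx, if_false]
      exact Finset.sum_nonneg fun i _ => hn i
  calc indepMass K u w (d + 1) ≤ ∑ x : Fin (d + 1) → Z, ∑ i : Fin (d + 1),
        (if u (x i) ∈ U then 0 else w (x i)) *
          indepWeight K u w (fun m => x (i.succAbove m)) :=
        Finset.sum_le_sum fun x _ => key x
    _ = ∑ i : Fin (d + 1), massOff u w U * indepMass K u w d := by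
        rw [Finset.sum_comm]
        refine Finset.sum_congr rfl fun i _ => ?_
        rw [← (Fin.insertNthEquiv (fun _ => Z) i).sum_comp, Fintype.sum_prod_type]
        simp only [Fin.insertNthEquiv_apply, Fin.insertNth_apply_same,
          Fin.insertNth_apply_succAbove]
        rw [massOff, indepMass, Finset.sum_mul_sum]
    _ = (d + 1) * massOff u w U * indepMass K u w d := by
        simp [mul_assoc]

open Classical in
/-- If one more sample rarely enlarges the span of an independent `j`-tuple, while it often
enlarges the span of shorter ones, then most independent `j`-tuples have the same span. -/
lemma exists_dominant_span [FiniteDimensional K V] (hw : ∀ z, 0 ≤ w z) {j : ℕ} {κ L : ℝ}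
    (hL : 0 < L) (hjL : (j : ℝ) ≤ L) (hpos : 0 < indepMass K u w j)
    (hle : indepMass K u w (j + 1) ≤ κ * indepMass K u w j)
    (hgt : ∀ d < j, (d + 1) * (4 * L * κ) * indepMass K u w d < indepMass K u w (d + 1)) :
    ∃ U : Submodule K V, (∃ x : Fin j → Z, (∀ i, 0 < w (x i)) ∧ U = tupleSpan K u x) ∧
      3 / 4 * indepMass K u w j ≤
        ∑ x : Fin j → Z, (if tupleSpan K u x = U then indepWeight K u w x else 0) ∧
      massOff u w U ≤ 4 / 3 * κ := by
  set q := indepMass K u w j with hq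
  let miss : Z → ℝ := fun z =>
    ∑ x : Fin j → Z, if u z ∈ tupleSpan K u x then 0 else indepWeight K u w x
  have hmiss0 : ∀ z, 0 ≤ miss z := fun z =>
    Finset.sum_nonneg fun x _ => by split_ifs <;> simp [indepWeight_nonneg hw]
  have hmiss : ∑ z, w z * miss z = indepMass K u w (j + 1) := by
    rw [indepMass_succ]
    simp only [massOff, miss, Finset.mul_sum]
    rw [Finset.sum_comm]
    refine Finset.sum_congr rfl fun x _ => Finset.sum_congr rfl fun z _ => ?_
    split_ifs <;> simp [mul_comm]
  let M : Set Z := {z | 0 < w z ∧ miss z ≤ q / (4 * L)}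
  have hoff : massOff u w (Submodule.span K (u '' M)) ≤ 4 * L * κ := by
    have h1 : massOff u w (Submodule.span K (u '' M)) * (q / (4 * L)) ≤ κ * q := by
      refine le_trans ?_ hle
      rw [← hmiss, massOff, Finset.sum_mul]
      refine Finset.sum_le_sum fun z _ => ?_
      split_ifs with hz
      · rw [zero_mul]
        exact mul_nonneg (hw z) (hmiss0 z)
      · rcases (hw z).eq_or_lt with h0 | h0
        · simp [← h0]
        · refine mul_le_mul_of_nonneg_left ?_ (hw z)
          by_contra! hlt
          exact hz (Submodule.subset_span ⟨z, ⟨h0, hlt.le⟩, rfl⟩)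
    have h2 : massOff u w (Submodule.span K (u '' M)) * (q / (4 * L)) =
      massOff u w (Submodule.span K (u '' M)) / (4 * L) * q := by ring
    rw [h2] at h1
    have h3 := le_of_mul_le_mul_right h1 hpos
    rw [div_le_iff₀ (by positivity)] at h3
    linarith
  have hdim : j ≤ Module.finrank K (Submodule.span K (u '' M)) := by
    by_contra! hlt
    have h1 := hgt _ hlt
    have h2 := indepMass_succ_le (u := u) hw (Submodule.span K (u '' M)) le_rfl
    refine absurd (h1.trans_le h2) (not_lt.2 ?_)
    gcongr
    exact indepMass_nonneg hw _
  obtain ⟨g, hgM, -, hgi⟩ := Submodule.exists_fun_fin_finrank_span_eq K (u '' M)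
  choose y hyM hyu using hgM
  let x₀ : Fin j → Z := fun i => y (Fin.castLE hdim i)
  have hx₀ : LinearIndependent K (u ∘ x₀) := by
    have : u ∘ x₀ = g ∘ Fin.castLE hdim := by
      funext i
      exact hyu _
    rw [this]
    exact hgi.comp _ (Fin.castLE_injective hdim)
  have hagree : 3 / 4 * q ≤ ∑ x : Fin j → Z,
      (if tupleSpan K u x = tupleSpan K u x₀ then indepWeight K u w x else 0) := by
    have h1 : ∀ x : Fin j → Z, indepWeight K u w x ≤
        (if tupleSpan K u x = tupleSpan K u x₀ then indepWeight K u w x else 0) +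
          ∑ i, if u (x₀ i) ∈ tupleSpan K u x then 0 else indepWeight K u w x := by
      intro x
      have hn : ∀ i, 0 ≤ if u (x₀ i) ∈ tupleSpan K u x then 0 else indepWeight K u w x :=
        fun i => by split_ifs <;> simp [indepWeight_nonneg hw]
      by_cases hs : tupleSpan K u x = tupleSpan K u x₀
      · rw [if_pos hs]
        exact le_add_of_nonneg_right (Finset.sum_nonneg fun i _ => hn i)
      rw [if_neg hs, zero_add]
      by_cases hx : LinearIndependent K (u ∘ x)
      · obtain ⟨i, hi⟩ : ∃ i, u (x₀ i) ∉ tupleSpan K u x := by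
          by_contra! hall
          refine hs (Submodule.eq_of_le_of_finrank_eq ?_ ?_).symm
          · refine Submodule.span_le.2 ?_
            rintro _ ⟨i, rfl⟩
            exact hall i
          · exact (finrank_span_eq_card hx₀).trans (finrank_span_eq_card hx).symm
        refine le_trans (le_of_eq ?_)
          (Finset.single_le_sum (fun i _ => hn i) (Finset.mem_univ i))
        rw [if_neg hi]
      · have : indepWeight K u w x = 0 := by simp [indepWeight, hx]
        rw [this]
        simp
    have h2 : q ≤ _ := Finset.sum_le_sum fun x (_ : x ∈ Finset.univ) => h1 x
    rw [Finset.sum_add_distrib, Finset.sum_comm (t := (Finset.univ : Finset (Fin j)))] at h2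
    have h3 : ∑ i : Fin j, miss (x₀ i) ≤ q / 4 := by
      calc ∑ i : Fin j, miss (x₀ i) ≤ ∑ _i : Fin j, q / (4 * L) :=
            Finset.sum_le_sum fun i _ => (hyM _).2
        _ = j * (q / (4 * L)) := by simp
        _ ≤ L * (q / (4 * L)) := by gcongr
        _ = q / 4 := by field_simp
    simp only [miss] at h3
    linarith
  refine ⟨tupleSpan K u x₀, ⟨x₀, fun i => (hyM _).1, rfl⟩, hagree, ?_⟩
  have h1 : 3 / 4 * q * massOff u w (tupleSpan K u x₀) ≤ κ * q := by
    refine le_trans ?_ hle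
    refine le_trans (mul_le_mul_of_nonneg_right hagree (massOff_nonneg hw _)) ?_
    rw [indepMass_succ, Finset.sum_mul]
    refine Finset.sum_le_sum fun x _ => ?_
    split_ifs with hs
    · rw [hs]
    · rw [zero_mul]
      exact mul_nonneg (indepWeight_nonneg hw _) (massOff_nonneg hw _)
  have h2 : 3 / 4 * massOff u w (tupleSpan K u x₀) * q ≤ κ * q := by linarith
  have h3 := le_of_mul_le_mul_right h2 hpos
  linarith

end IndependentTuples

section Oracles

variable {Z : Type}

open Classical in
lemma labeled_apply_toReal (P : PMF Z) (f : Z → ℤˣ) (z : Z) (b : ℤˣ) :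
    (labeled P f (z, b)).toReal = if b = f z then (P z).toReal else 0 := by
  have h : labeled P f (z, b) = if b = f z then P z else 0 := by
    rw [labeled, PMF.map_apply, tsum_eq_single z]
    · simp
    · intro z' hz'
      simp [Prod.ext_iff, hz'.symm]
  rw [h]
  split_ifs <;> simp

lemma sum_toReal_eq_one [Fintype Z] (P : PMF Z) : ∑ z, (P z).toReal = 1 := by
  rw [← ENNReal.toReal_sum fun z _ => P.apply_ne_top z, ← tsum_fintype (L := .unconditional Z),
    P.tsum_coe]
  simp

lemma expect_labeled [Fintype Z] {k : ℕ} (P : PMF Z) (f : Z → ℤˣ)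
    (φ : (Fin k → Z × ℤˣ) → ℝ) :
    expect (labeled P f) φ =
      ∑ y : Fin k → Z, (∏ i, (P (y i)).toReal) * φ (fun i => (y i, f (y i))) := by
  symm
  refine Fintype.sum_of_injective (fun (y : Fin k → Z) i => (y i, f (y i))) ?_ _ _ ?_ ?_
  · intro y y' h
    funext i
    exact congrArg Prod.fst (congrFun h i)
  · intro x hx
    obtain ⟨i, hi⟩ : ∃ i, (x i).2 ≠ f (x i).1 := by
      by_contra! hall
      exact hx ⟨fun i => (x i).1, funext fun i => Prod.ext rfl (hall i).symm⟩
    have h0 : (labeled P f (x i)).toReal = 0 := by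
      have := labeled_apply_toReal P f (x i).1 (x i).2
      rwa [if_neg hi] at this
    rw [Finset.prod_eq_zero (Finset.mem_univ i) h0, zero_mul]
  · intro y
    simp [labeled_apply_toReal]

lemma sum_prod_mul_castLE [Fintype Z] {w : Z → ℝ} (hw : ∑ z, w z = 1) {j m : ℕ} (h : j ≤ m)
    (ψ : (Fin j → Z) → ℝ) :
    ∑ y : Fin m → Z, (∏ i, w (y i)) * ψ (fun i => y (Fin.castLE h i)) =
      ∑ y : Fin j → Z, (∏ i, w (y i)) * ψ y := by
  induction m, h using Nat.le_induction with
  | base => simp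
  | succ m h ih =>
    rw [← ih, ← (Fin.snocEquiv fun _ => Z).sum_comp, Fintype.sum_prod_type_right]
    refine Finset.sum_congr rfl fun y _ => ?_
    have hc : ∀ (z : Z) (i : Fin j),
        (Fin.snoc y z : Fin (m + 1) → Z) (Fin.castLE (h.trans (Nat.le_succ m)) i) =
          y (Fin.castLE h i) := fun z i =>
      Fin.snoc_castSucc (α := fun _ => Z) z y (Fin.castLE h i)
    simp only [Fin.snocEquiv_apply, Fin.prod_univ_castSucc, Fin.snoc_castSucc, Fin.snoc_last, hc]
    rw [← Finset.sum_mul, ← Finset.mul_sum, hw, mul_one]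

/-- A non-adaptive algorithm: it asks the queries `φ i` and outputs a function of the answers. -/
lemma exists_nonadaptive {k : ℕ} {X H ι : Type} [Fintype ι] (φ : ι → Query k X)
    (g : (ι → ℝ) → H) :
    ∃ A : SQAlg k X H, ∀ O : Query k X → ℝ,
      A.numQueries O = Fintype.card ι ∧ A.run O = g fun i => O (φ i) := by
  have main : ∀ (T : ℕ) (φ : Fin T → Query k X) (g : (Fin T → ℝ) → H),
      ∃ A : SQAlg k X H, ∀ O : Query k X → ℝ,
        A.numQueries O = T ∧ A.run O = g fun i => O (φ i) := by
    intro T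
    induction T with
    | zero =>
      intro φ g
      refine ⟨.output (g Fin.elim0), fun O => ⟨rfl, ?_⟩⟩
      exact congrArg g (funext fun i => i.elim0)
    | succ T ih =>
      intro φ g
      choose B hB using fun v : ℝ => ih (fun i => φ i.succ) (fun a => g (Fin.cons v a))
      refine ⟨.query (φ 0) B, fun O => ⟨?_, ?_⟩⟩
      · simp [SQAlg.numQueries, (hB _ O).1]
      · rw [SQAlg.run, (hB _ O).2]
        congr 1
        funext i
        refine Fin.cases ?_ (fun i => ?_) i <;> simp
  obtain ⟨A, hA⟩ := main (Fintype.card ι) (fun i => φ ((Fintype.equivFin ι).symm i))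
    (fun a => g fun i => a (Fintype.equivFin ι i))
  exact ⟨A, fun O => by simpa using hA O⟩

lemma err_le_one [Fintype Z] (P : PMF Z) (f h : Z → ℤˣ) : err P f h ≤ 1 := by
  rw [← sum_toReal_eq_one P]
  exact Finset.sum_le_sum_of_subset_of_nonneg (Finset.filter_subset _ _)
    fun _ _ _ => ENNReal.toReal_nonneg

lemma err_nonneg [Fintype Z] (P : PMF Z) (f h : Z → ℤˣ) : 0 ≤ err P f h :=
  Finset.sum_nonneg fun _ _ => ENNReal.toReal_nonneg

end Oracles

section Learner

variable (K : Type) {V Z : Type} [Field K] [AddCommGroup V] [Module K V] (u : Z → V)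

open Classical in
/-- The query asking whether the first `j` examples are positive, have independent vectors, and
span a subspace in `S`. -/
def spanQuery {m j : ℕ} (h : j ≤ m) (S : Set (Submodule K V)) : Query m (Z × ℤˣ) := fun x =>
  if (∀ i, (x (Fin.castLE h i)).2 = 1) ∧
      LinearIndependent K (u ∘ fun i => (x (Fin.castLE h i)).1) ∧
      tupleSpan K u (fun i => (x (Fin.castLE h i)).1) ∈ S
  then ⟨1, by norm_num⟩ else ⟨0, by norm_num⟩

open Classical in
/-- The probability weights restricted to the positive examples. -/
def posWeight (P : PMF Z) (f : Z → ℤˣ) (z : Z) : ℝ :=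
  if f z = 1 then (P z).toReal else 0

lemma posWeight_nonneg (P : PMF Z) (f : Z → ℤˣ) (z : Z) : 0 ≤ posWeight P f z := by
  unfold posWeight
  split_ifs <;> simp

open Classical in
lemma expect_spanQuery [Fintype Z] {m j : ℕ} (h : j ≤ m) (S : Set (Submodule K V)) (P : PMF Z)
    (f : Z → ℤˣ) :
    expect (labeled P f) (fun x => (spanQuery K u h S x : ℝ)) =
      ∑ y : Fin j → Z,
        if tupleSpan K u y ∈ S then indepWeight K u (posWeight P f) y else 0 := by
  rw [expect_labeled]
  have hm := sum_prod_mul_castLE (sum_toReal_eq_one P) h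
    fun y => if (∀ i, f (y i) = 1) ∧ LinearIndependent K (u ∘ y) ∧ tupleSpan K u y ∈ S
      then (1 : ℝ) else 0
  refine Eq.trans (Finset.sum_congr rfl fun y _ => ?_)
    (hm.trans (Finset.sum_congr rfl fun y _ => ?_))
  · congr 1
    unfold spanQuery
    split_ifs <;> rfl
  · by_cases hf : ∀ i, f (y i) = 1
    · by_cases hi : LinearIndependent K (u ∘ y) <;>
        by_cases hS : tupleSpan K u y ∈ S <;> simp [hf, hi, hS, indepWeight, posWeight]
    · have hz : indepWeight K u (posWeight P f) y = 0 := by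
        push Not at hf
        obtain ⟨i, hi⟩ := hf
        unfold indepWeight
        rw [Finset.prod_eq_zero (Finset.mem_univ i) (by simp [posWeight, hi]), ite_self]
      simp [hf, hz]

variable {K u}

open Classical in
/-- Approximate values of the independent masses locate a `j` at which `exists_dominant_span`
applies. -/
lemma exists_dominant_span_of_estimates [Fintype Z] [FiniteDimensional K V] {w : Z → ℝ}
    (hw : ∀ z, 0 ≤ w z) {l : ℕ} (hl : 1 ≤ l) {ε β τ : ℝ} (hε : 0 < ε) (hε1 : ε ≤ 1)
    (hβ : β = 1 / (32 * (l : ℝ) ^ 2)) (hvan : indepMass K u w (l + 1) = 0)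
    (hτ : τ ≤ (β ^ l * ε) ^ l / 16) (Q : ℕ → ℝ)
    (hQ : ∀ i ≤ l, |Q i - indepMass K u w i| ≤ τ) {j : ℕ} (hj : j ≤ l)
    (hhalt : j = l ∨ Q (j + 1) < β ^ (j + 1) * ε * Q j)
    (hgo : ∀ i < j, β ^ (i + 1) * ε * Q i ≤ Q (i + 1)) :
    0 < indepMass K u w j ∧ τ ≤ indepMass K u w j / 7 ∧
    ∃ U : Submodule K V, (∃ x : Fin j → Z, (∀ i, 0 < w (x i)) ∧ U = tupleSpan K u x) ∧
      3 / 4 * indepMass K u w j ≤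
        ∑ x : Fin j → Z, (if tupleSpan K u x = U then indepWeight K u w x else 0) ∧
      massOff u w U ≤ ε := by
  have hl1 : (1 : ℝ) ≤ l := by exact_mod_cast hl
  have hβ0 : 0 < β := by rw [hβ]; positivity
  have hβ32 : β * (32 * (l : ℝ) ^ 2) = 1 := by rw [hβ]; field_simp
  have hβs : β ≤ 1 / 32 := by
    rw [hβ]
    gcongr
    nlinarith
  set γ := β ^ l with hγ
  have hγ0 : 0 < γ := by positivity
  have hγ1 : γ ≤ 1 := pow_le_one₀ hβ0.le (by linarith)
  have hγε : γ * ε ≤ 1 := mul_le_one₀ hγ1 hε.le hε1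
  have hγβ : ∀ i < l, γ ≤ β ^ (i + 1) := fun i hi =>
    pow_le_pow_of_le_one hβ0.le (by linarith) hi
  have hτi : ∀ i ≤ l, τ ≤ (γ * ε) ^ i / 16 := fun i hi => by
    have := pow_le_pow_of_le_one (by positivity) hγε hi
    linarith
  have hQlow : ∀ i ≤ j, (γ * ε) ^ i / 2 ≤ Q i := by
    intro i
    induction i with
    | zero =>
      intro _
      have h1 := abs_le.1 (hQ 0 (Nat.zero_le _))
      have h2 := hτi 0 (Nat.zero_le _)
      rw [indepMass_zero] at h1
      rw [pow_zero] at h2 ⊢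
      linarith [h1.1]
    | succ i ih =>
      intro hi
      have h1 := ih (by omega)
      refine le_trans ?_ (hgo i (by omega))
      calc (γ * ε) ^ (i + 1) / 2 = γ * ε * ((γ * ε) ^ i / 2) := by ring
        _ ≤ β ^ (i + 1) * ε * Q i := by
          gcongr
          exact hγβ i (by omega)
  have hQτ : ∀ i ≤ j, 8 * τ ≤ Q i := fun i hi => by
    have := hτi i (by omega)
    have := hQlow i hi
    linarith
  have hQ0 : ∀ i ≤ j, 0 < Q i := fun i hi =>
    lt_of_lt_of_le (by positivity) (hQlow i hi)
  have hlow : ∀ i ≤ j, 7 / 8 * Q i ≤ indepMass K u w i := fun i hi => by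
    have := (abs_le.1 (hQ i (by omega))).2
    have := hQτ i hi
    linarith
  have hupp : ∀ i ≤ j, indepMass K u w i ≤ 9 / 8 * Q i := fun i hi => by
    have := (abs_le.1 (hQ i (by omega))).1
    have := hQτ i hi
    linarith
  have hpos : 0 < indepMass K u w j := lt_of_lt_of_le (by linarith [hQ0 j le_rfl]) (hlow j le_rfl)
  refine ⟨hpos, by linarith [hQτ j le_rfl, hlow j le_rfl], ?_⟩
  have hgrow : ∀ d < j, β ^ (d + 1) * ε / 2 * indepMass K u w d ≤ indepMass K u w (d + 1) := by
    intro d hd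
    have h1 := hgo d hd
    have h2 := hlow (d + 1) hd
    have h3 := hupp d hd.le
    have h4 : β ^ (d + 1) * ε / 2 * indepMass K u w d ≤ β ^ (d + 1) * ε / 2 * (9 / 8 * Q d) := by
      gcongr
    have h5 : 0 < β ^ (d + 1) * ε * Q d := by
      have := hQ0 d hd.le
      positivity
    linarith
  have hmpos : ∀ d ≤ j, 0 < indepMass K u w d := fun d hd =>
    lt_of_lt_of_le (by linarith [hQ0 d hd]) (hlow d hd)
  obtain ⟨κ, hle, hκε, hκβ⟩ : ∃ κ, indepMass K u w (j + 1) ≤ κ * indepMass K u w j ∧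
      4 / 3 * κ ≤ ε ∧ ∀ d < j, κ ≤ 2 * β * β ^ (d + 1) * ε := by
    rcases hj.eq_or_lt with hjl | hjl
    · refine ⟨0, by rw [hjl, hvan, zero_mul], by linarith, fun d _ => by positivity⟩
    · have hlt : Q (j + 1) < β ^ (j + 1) * ε * Q j := hhalt.resolve_left hjl.ne
      refine ⟨2 * β ^ (j + 1) * ε, ?_, ?_, ?_⟩
      · have h1 := (abs_le.1 (hQ (j + 1) hjl)).1
        have h2 : τ ≤ β ^ (j + 1) * ε * Q j / 8 := by
          refine (hτi (j + 1) hjl).trans ?_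
          have : γ * ε * ((γ * ε) ^ j / 2) ≤ β ^ (j + 1) * ε * Q j := by
            gcongr
            · exact hγβ j hjl
            · exact hQlow j le_rfl
          have h3 : (γ * ε) ^ (j + 1) / 16 = γ * ε * ((γ * ε) ^ j / 2) / 8 := by ring
          linarith
        have h3 : 2 * β ^ (j + 1) * ε * (7 / 8 * Q j) ≤
            2 * β ^ (j + 1) * ε * indepMass K u w j := by
          gcongr
          exact hlow j le_rfl
        have h5 : 0 < β ^ (j + 1) * ε * Q j := by
          have := hQ0 j le_rfl
          positivity
        linarith
      · have : β ^ (j + 1) ≤ β := by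
          simpa using pow_le_pow_of_le_one hβ0.le (by linarith) (Nat.le_add_left 1 j)
        nlinarith
      · intro d hd
        have : β ^ (j + 1) ≤ β ^ (d + 2) :=
          pow_le_pow_of_le_one hβ0.le (by linarith) (by omega)
        calc 2 * β ^ (j + 1) * ε ≤ 2 * β ^ (d + 2) * ε := by gcongr
          _ = 2 * β * β ^ (d + 1) * ε := by ring
  obtain ⟨U, hU1, hU2, hU3⟩ := exists_dominant_span (L := (l : ℝ)) hw (by linarith)
    (by exact_mod_cast hj) hpos hle (fun d hd => by
      refine lt_of_lt_of_le ?_ (hgrow d hd)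
      refine mul_lt_mul_of_pos_right ?_ (hmpos d hd.le)
      have hd' : ((d : ℝ) + 1) ≤ l := by exact_mod_cast (by omega : d + 1 ≤ l)
      calc ((d : ℝ) + 1) * (4 * l * κ) ≤ ((d : ℝ) + 1) * (4 * l * (2 * β * β ^ (d + 1) * ε)) := by
            gcongr
            exact hκβ d hd
        _ ≤ l * (4 * l * (2 * β * β ^ (d + 1) * ε)) := by gcongr
        _ = β * (32 * (l : ℝ) ^ 2) * (β ^ (d + 1) * ε / 4) := by ring
        _ = β ^ (d + 1) * ε / 4 := by rw [hβ32, one_mul]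
        _ < β ^ (d + 1) * ε / 2 := by
          have : 0 < β ^ (d + 1) * ε := by positivity
          linarith)
  exact ⟨U, hU1, hU2, hU3.trans hκε⟩

/-- Classes of `±1` indicators of sets cut out by subspaces of dimension at most `l` are
learnable from few `l`-wise queries. -/
theorem detLearnable_of_subspaces [Fintype Z] [FiniteDimensional K V] [Finite (Submodule K V)]
    {C : Set (Z → ℤˣ)} {l N : ℕ} (hl : 1 ≤ l)
    (hC : ∀ f ∈ C, ∃ T : Submodule K V, Module.finrank K T ≤ l ∧ ∀ z, f z = 1 ↔ u z ∈ T)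
    (hN : Nat.card (Submodule K V) ≤ 2 ^ N) {ε τ : ℝ} (hε : 0 < ε) (hε1 : ε ≤ 1)
    (hτ : τ ≤ ((1 / (32 * (l : ℝ) ^ 2)) ^ l * ε) ^ l / 16) :
    DetLearnable l C ε τ ((l + 1) * (N + 1)) := by
  classical
  obtain ⟨enc, henc⟩ : ∃ enc : Submodule K V → ℕ,
      ∀ U U', (∀ b < N, (enc U).testBit b = (enc U').testBit b) → U = U' := by
    refine ⟨fun U => (Finite.equivFin (Submodule K V) U : ℕ), fun U U' h => ?_⟩
    refine (Finite.equivFin (Submodule K V)).injective (Fin.ext (Nat.eq_of_testBit_eq fun b => ?_))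
    by_cases hb : b < N
    · exact h b hb
    · have hlt : ∀ U, (Finite.equivFin (Submodule K V) U : ℕ) < 2 ^ b := fun U =>
        lt_of_lt_of_le (Fin.isLt _) (hN.trans (Nat.pow_le_pow_right two_pos (not_lt.1 hb)))
      rw [Nat.testBit_lt_two_pow (hlt _), Nat.testBit_lt_two_pow (hlt _)]
  set β : ℝ := 1 / (32 * (l : ℝ) ^ 2) with hβ
  let S : Option (Fin N) → Set (Submodule K V) := fun o =>
    o.elim Set.univ fun b => {U | (enc U).testBit b = true}
  let Q : (Fin (l + 1) × Option (Fin N) → ℝ) → ℕ → ℝ := fun a i =>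
    if h : i < l + 1 then a (⟨i, h⟩, none) else 0
  have hex : ∀ a, ∃ j, j = l ∨ Q a (j + 1) < β ^ (j + 1) * ε * Q a j := fun a => ⟨l, .inl rfl⟩
  have hfind : ∀ a, Nat.find (hex a) ≤ l := fun a => Nat.find_min' _ (.inl rfl)
  let J : (Fin (l + 1) × Option (Fin N) → ℝ) → Fin (l + 1) := fun a =>
    ⟨Nat.find (hex a), Nat.lt_succ_of_le (hfind a)⟩
  let good : (Fin (l + 1) × Option (Fin N) → ℝ) → Submodule K V → Prop := fun a U =>
    ∀ b : Fin N, (enc U).testBit b = true ↔ a (J a, none) / 2 ≤ a (J a, some b)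
  let out : (Fin (l + 1) × Option (Fin N) → ℝ) → Z → ℤˣ := fun a z =>
    if ∃ U, good a U ∧ u z ∈ U then 1 else -1
  obtain ⟨A, hA⟩ := exists_nonadaptive
    (fun i : Fin (l + 1) × Option (Fin N) => spanQuery K u (Nat.le_of_lt_succ i.1.2) (S i.2)) out
  refine ⟨A, fun P f hf O hO => ⟨?_, ?_⟩⟩
  · rw [(hA O).1]
    simp
  rw [(hA O).2]
  set a : Fin (l + 1) × Option (Fin N) → ℝ :=
    fun i => O (spanQuery K u (Nat.le_of_lt_succ i.1.2) (S i.2)) with ha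
  set w := posWeight P f with hw
  have hw0 : ∀ z, 0 ≤ w z := posWeight_nonneg P f
  obtain ⟨T, hT, hfT⟩ := hC f hf
  have hest : ∀ (i : Fin (l + 1)) o, |a (i, o) - ∑ y : Fin i → Z,
      (if tupleSpan K u y ∈ S o then indepWeight K u w y else 0)| ≤ τ := by
    intro i o
    have := hO (spanQuery K u (Nat.le_of_lt_succ i.2) (S o))
    rwa [expect_spanQuery] at this
  have hQ : ∀ i ≤ l, |Q a i - indepMass K u w i| ≤ τ := by
    intro i hi
    have := hest ⟨i, Nat.lt_succ_of_le hi⟩ none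
    simpa [Q, S, hi, indepMass] using this
  have hvan : indepMass K u w (l + 1) = 0 := by
    refine le_antisymm ?_ (indepMass_nonneg hw0 _)
    refine (indepMass_succ_le hw0 T hT).trans (le_of_eq ?_)
    have : massOff u w T = 0 := by
      refine Finset.sum_eq_zero fun z _ => ?_
      split_ifs with hz
      · rfl
      · rw [hw, posWeight, if_neg (mt (hfT z).1 hz)]
    rw [this, mul_zero, zero_mul]
  obtain ⟨hpos, hτ7, U, ⟨x, hx, hUx⟩, hU, hUε⟩ :=
    exists_dominant_span_of_estimates (K := K) (u := u) hw0 hl hε hε1 hβ hvan hτ (Q a) hQ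
      (hfind a) (Nat.find_spec (hex a)) (fun i hi => by
        have := Nat.find_min (hex a) hi
        push Not at this
        exact this.2)
  set j := Nat.find (hex a) with hj
  have hnone : |a (J a, none) - indepMass K u w j| ≤ τ := by
    simpa [S, indepMass, J] using hest (J a) none
  have hgood : good a U := by
    intro b
    have hb : |a (J a, some b) - ∑ y : Fin j → Z,
        (if (enc (tupleSpan K u y)).testBit b = true then indepWeight K u w y else 0)| ≤ τ := by
      convert hest (J a) (some b)
      exact Iff.rfl
    rw [abs_le] at hb
    have hn := abs_le.1 hnone
    constructor
    · intro hbit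
      have : ∑ x : Fin j → Z, (if tupleSpan K u x = U then indepWeight K u w x else 0) ≤
          ∑ y : Fin j → Z, if (enc (tupleSpan K u y)).testBit b = true then
            indepWeight K u w y else 0 := by
        refine Finset.sum_le_sum fun y _ => ?_
        by_cases hy : tupleSpan K u y = U
        · simp [hy, hbit]
        · rw [if_neg hy]
          split_ifs <;> simp [indepWeight_nonneg hw0]
      linarith [hb.1, hn.2]
    · intro hle
      by_contra hbit
      have : (∑ x : Fin j → Z, (if tupleSpan K u x = U then indepWeight K u w x else 0)) +
          (∑ y : Fin j → Z, if (enc (tupleSpan K u y)).testBit b = true then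
            indepWeight K u w y else 0) ≤ indepMass K u w j := by
        rw [← Finset.sum_add_distrib]
        refine Finset.sum_le_sum fun y _ => ?_
        by_cases hy : tupleSpan K u y = U
        · simp [hy, hbit]
        · rw [if_neg hy]
          split_ifs <;> simp [indepWeight_nonneg hw0]
      linarith [hb.2, hn.1]
  have huniq : ∀ U', good a U' → U' = U := fun U' hU' =>
    henc _ _ fun b hb => Bool.eq_iff_iff.2 ((hU' ⟨b, hb⟩).trans (hgood ⟨b, hb⟩).symm)
  have hout : ∀ z, out a z = if u z ∈ U then 1 else -1 := by
    intro z
    have : (∃ U, good a U ∧ u z ∈ U) ↔ u z ∈ U :=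
      ⟨fun ⟨U', h1, h2⟩ => huniq U' h1 ▸ h2, fun h => ⟨U, hgood, h⟩⟩
    simp only [out, this]
  have hUT : U ≤ T := by
    rw [hUx]
    refine Submodule.span_le.2 ?_
    rintro _ ⟨i, rfl⟩
    refine (hfT _).1 ?_
    by_contra hne
    have := hx i
    rw [hw, posWeight, if_neg hne] at this
    exact this.false
  refine le_trans ?_ hUε
  rw [err, Finset.sum_filter, massOff]
  refine Finset.sum_le_sum fun z _ => ?_
  rw [hout z]
  by_cases hz : u z ∈ U
  · simp [hz, (hfT z).2 (hUT hz)]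
  · rcases Int.units_eq_one_or (f z) with h | h
    · simp [hz, h, hw, posWeight]
    · simp [hz, h, hw, posWeight]

end Learner

lemma card_submodule_le (K V : Type) [Field K] [AddCommGroup V] [Module K V] [Finite K]
    [FiniteDimensional K V] :
    Finite (Submodule K V) ∧ Nat.card (Submodule K V) ≤ Nat.card K ^ Module.finrank K V ^ 2 := by
  have hs : Function.Surjective (LinearMap.range : (V →ₗ[K] V) → Submodule K V) := by
    intro U
    obtain ⟨g, hg⟩ := LinearMap.exists_leftInverse_of_injective U.subtype U.ker_subtype
    refine ⟨U.subtype ∘ₗ g, ?_⟩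
    rw [LinearMap.range_comp, LinearMap.range_eq_top.2, Submodule.map_top, Submodule.range_subtype]
    exact fun y => ⟨y, LinearMap.congr_fun hg y⟩
  have : Finite (V →ₗ[K] V) := Module.finite_of_finite K
  refine ⟨Finite.of_surjective _ hs, (Nat.card_le_card_of_surjective _ hs).trans (le_of_eq ?_)⟩
  rw [Module.natCard_eq_pow_finrank (K := K), Module.finrank_linearMap, sq]

lemma DetLearnable.mono {Z : Type} [Fintype Z] {k : ℕ} {C : Set (Z → ℤˣ)} {ε τ : ℝ} {q q' : ℕ}
    (h : DetLearnable k C ε τ q) (hq : q ≤ q') : DetLearnable k C ε τ q' := by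
  obtain ⟨A, hA⟩ := h
  exact ⟨A, fun P f hf O hO => ⟨(hA P f hf O hO).1.trans hq, (hA P f hf O hO).2⟩⟩

lemma hypFun_eq_one_iff {p n : ℕ} (a z : Fin (n + 1) → ZMod p) :
    hypFun a z = 1 ↔ z ∈ hyp a := by
  unfold hypFun
  split_ifs with h <;> simp [h]

/-- In homogeneous coordinates `(z, 1)`, an affine hyperplane is cut out by a linear subspace. -/
lemma exists_submodule_hypFun {p k : ℕ} [Fact p.Prime] (a : Fin (k + 1) → ZMod p) :
    ∃ T : Submodule (ZMod p) ((Fin (k + 1) → ZMod p) × ZMod p),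
      Module.finrank (ZMod p) T ≤ k + 1 ∧
        ∀ z, hypFun a z = 1 ↔ ((z, 1) : (Fin (k + 1) → ZMod p) × ZMod p) ∈ T := by
  let φ : ((Fin (k + 1) → ZMod p) × ZMod p) →ₗ[ZMod p] ZMod p :=
    { toFun := fun v => ∑ i : Fin k, a i.castSucc * v.1 i.castSucc + a (Fin.last k) * v.2 -
        v.1 (Fin.last k)
      map_add' := fun v v' => by
        simp only [Prod.fst_add, Prod.snd_add, Pi.add_apply, mul_add, Finset.sum_add_distrib]
        ring
      map_smul' := fun c v => by
        have : ∀ i : Fin k, a i.castSucc * (c * v.1 i.castSucc) =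
          c * (a i.castSucc * v.1 i.castSucc) := fun i => by ring
        simp only [Prod.smul_fst, Prod.smul_snd, Pi.smul_apply, smul_eq_mul, RingHom.id_apply,
          this, ← Finset.mul_sum]
        ring }
  refine ⟨LinearMap.ker φ, ?_, fun z => ?_⟩
  · have hne : LinearMap.ker φ ≠ ⊤ := by
      intro h
      have h1 : ((Pi.single (Fin.last k) 1, 0) : (Fin (k + 1) → ZMod p) × ZMod p) ∈
        LinearMap.ker φ := h ▸ Submodule.mem_top
      simp [φ, LinearMap.mem_ker, Fin.castSucc_ne_last] at h1
    have := Submodule.finrank_lt (lt_top_iff_ne_top.2 hne).ne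
    simp at this
    omega
  · rw [hypFun_eq_one_iff, LinearMap.mem_ker]
    change _ = _ ↔ ∑ i : Fin k, a i.castSucc * z i.castSucc + a (Fin.last k) * 1 -
      z (Fin.last k) = 0
    rw [mul_one, sub_eq_zero, eq_comm]

lemma clog_two_le_log {p : ℕ} (hp : 2 ≤ p) :
    (Nat.clog 2 p : ℝ) ≤ 2 / Real.log 2 * Real.log p := by
  have h2 : 0 < Real.log 2 := Real.log_pos (by norm_num)
  have hlog : Real.log 2 ≤ Real.log p :=
    Real.log_le_log (by norm_num) (by exact_mod_cast hp)
  have h1 : (2 : ℝ) ^ (Nat.clog 2 p - 1) ≤ p := by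
    exact_mod_cast (Nat.pow_pred_clog_lt_self (by norm_num) hp).le
  have h3 := Real.log_le_log (by positivity) h1
  rw [Real.log_pow] at h3
  have h4 : (Nat.clog 2 p : ℝ) ≤ ((Nat.clog 2 p - 1 : ℕ) : ℝ) + 1 := by
    exact_mod_cast (by omega : Nat.clog 2 p ≤ Nat.clog 2 p - 1 + 1)
  rw [div_mul_eq_mul_div, le_div_iff₀ h2]
  nlinarith

/-- The upper bound for `(k+1)`-wise queries. -/
theorem hypClass_upper_bound (k : ℕ) :
    ∃ c : ℝ, 0 < c ∧ ∀ (p : ℕ) [Fact p.Prime],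
      ∃ t : ℕ, 1 ≤ t ∧ (t : ℝ) ≤ c * Real.log p ∧
        ∀ ε : ℝ, 0 < ε →
          DetLearnable (k + 1) (hypClass p k) ε (ε ^ (k + 1) / t) t := by
  set γ : ℝ := (1 / (32 * ((k + 1 : ℕ) : ℝ) ^ 2)) ^ (k + 1) with hγ
  have hγ0 : 0 < γ := by positivity
  set s : ℕ := ⌈16 / γ ^ (k + 1)⌉₊ with hs
  have h2 : 0 < Real.log 2 := Real.log_pos (by norm_num)
  refine ⟨(((k + 2) * ((k + 2) ^ 2 + 1) + s : ℕ) : ℝ) * (2 / Real.log 2), by positivity, ?_⟩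
  intro p hpr
  have hp := hpr.out
  set N := Nat.clog 2 p * (k + 2) ^ 2 with hN
  have hclog : 1 ≤ Nat.clog 2 p := Nat.clog_pos (by norm_num) hp.two_le
  have hst : (s : ℝ) ≤ ((k + 2) * (N + 1) + s : ℕ) := by
    exact_mod_cast Nat.le_add_left _ _
  refine ⟨(k + 2) * (N + 1) + s, ?_, ?_, fun ε hε => ?_⟩
  · nlinarith
  · rw [mul_assoc]
    refine le_trans ?_ (mul_le_mul_of_nonneg_left (clog_two_le_log hp.two_le) (by positivity))
    norm_cast
    have h1 : 1 ≤ Nat.clog 2 p := hclog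
    have h3 : s ≤ s * Nat.clog 2 p := Nat.le_mul_of_pos_right _ hclog
    have h4 : k + 2 ≤ (k + 2) * Nat.clog 2 p := Nat.le_mul_of_pos_right _ hclog
    calc (k + 2) * (N + 1) + s = (k + 2) * (k + 2) ^ 2 * Nat.clog 2 p + (k + 2) + s := by
          rw [hN]; ring
      _ ≤ (k + 2) * (k + 2) ^ 2 * Nat.clog 2 p + (k + 2) * Nat.clog 2 p + s * Nat.clog 2 p := by
          gcongr
      _ = ((k + 2) * ((k + 2) ^ 2 + 1) + s) * Nat.clog 2 p := by ring
  rcases le_total ε 1 with hε1 | hε1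
  · obtain ⟨hfin, hcard⟩ :=
      card_submodule_le (ZMod p) ((Fin (k + 1) → ZMod p) × ZMod p)
    refine DetLearnable.mono (detLearnable_of_subspaces (K := ZMod p)
      (V := (Fin (k + 1) → ZMod p) × ZMod p) (u := fun z => (z, 1)) (N := N)
      (Nat.le_add_left 1 k) ?_ ?_ hε hε1 ?_) (Nat.le_add_right _ s)
    · rintro _ ⟨a, rfl⟩
      exact exists_submodule_hypFun a
    · refine hcard.trans ?_
      have hd : Module.finrank (ZMod p) ((Fin (k + 1) → ZMod p) × ZMod p) = k + 2 := by simp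
      rw [hd, Nat.card_zmod, hN, pow_mul]
      exact Nat.pow_le_pow_left (Nat.le_pow_clog (by norm_num) p) _
    · rw [← hγ, mul_pow]
      have h16 : 16 / γ ^ (k + 1) ≤ ((k + 2) * (N + 1) + s : ℕ) := (Nat.le_ceil _).trans hst
      have ht : (0 : ℝ) < ((k + 2) * (N + 1) + s : ℕ) := lt_of_lt_of_le (by positivity) h16
      rw [div_le_iff₀ (by positivity)] at h16
      rw [div_le_div_iff₀ ht (by norm_num)]
      nlinarith [pow_pos hε (k + 1)]
  · refine ⟨.output fun _ => 1, fun P f _ O _ => ⟨Nat.zero_le _, ?_⟩⟩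
    exact (err_le_one _ _ _).trans hε1

section SecondMoment

/-- The average deviation of a `k`-wise query from its value at a reference distribution is
controlled by the pairwise correlations of the distributions. -/
lemma sq_sum_abs_sub_le {X ι : Type} [Fintype X] [Fintype ι] {D : ι → X → ℝ} {D₀ : X → ℝ}
    (hD₀ : ∀ x, 0 < D₀ x) (hD₀1 : ∑ x, D₀ x = 1) (hD1 : ∀ a, ∑ x, D a x = 1) {k : ℕ}
    {φ : (Fin k → X) → ℝ} (hφ : ∀ x, |φ x| ≤ 1) :
    (∑ a, |∑ x : Fin k → X, (∏ i, D a (x i)) * φ x - ∑ x : Fin k → X, (∏ i, D₀ (x i)) * φ x|) ^ 2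
      ≤ ∑ a, ∑ a', |(∑ x, D a x * D a' x / D₀ x) ^ k - 1| := by
  set W : (Fin k → X) → ℝ := fun x => ∏ i, D₀ (x i) with hW
  set E : ι → (Fin k → X) → ℝ := fun a x => ∏ i, D a (x i) with hE
  have hWpos : ∀ x, 0 < W x := fun x => Finset.prod_pos fun i _ => hD₀ _
  have hW1 : ∑ x, W x = 1 := by rw [hW, ← Fintype.sum_pow, hD₀1, one_pow]
  have hE1 : ∀ a, ∑ x, E a x = 1 := fun a => by rw [hE, ← Fintype.sum_pow, hD1, one_pow]
  have hσ : ∀ a, ∃ σ : ℝ, |σ| = 1 ∧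
      |∑ x, E a x * φ x - ∑ x, W x * φ x| = σ * (∑ x, E a x * φ x - ∑ x, W x * φ x) := by
    intro a
    rcases le_total 0 (∑ x, E a x * φ x - ∑ x, W x * φ x) with h | h
    · exact ⟨1, by simp, by rw [abs_of_nonneg h, one_mul]⟩
    · exact ⟨-1, by simp, by rw [abs_of_nonpos h, neg_one_mul]⟩
  choose σ hσ1 hσ using hσ
  set T : (Fin k → X) → ℝ := fun x => ∑ a, σ a * (E a x - W x) with hT
  have hsum : ∑ a, |∑ x, E a x * φ x - ∑ x, W x * φ x| = ∑ x, φ x * T x := by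
    rw [Finset.sum_congr rfl fun a _ => hσ a]
    simp only [hT, Finset.mul_sum, ← Finset.sum_sub_distrib]
    rw [Finset.sum_comm]
    exact Finset.sum_congr rfl fun x _ => Finset.sum_congr rfl fun a _ => by ring
  have hcross : ∀ a a', ∑ x, (E a x - W x) * (E a' x - W x) / W x =
      (∑ x, D a x * D a' x / D₀ x) ^ k - 1 := by
    intro a a'
    have h1 : ∀ x, (E a x - W x) * (E a' x - W x) / W x =
        E a x * E a' x / W x - E a x - E a' x + W x := fun x => by
      have := (hWpos x).ne'
      field_simp
      ring
    have h2 : ∑ x, E a x * E a' x / W x = (∑ x, D a x * D a' x / D₀ x) ^ k := by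
      rw [Fintype.sum_pow]
      exact Finset.sum_congr rfl fun x _ => by
        rw [Finset.prod_div_distrib, Finset.prod_mul_distrib]
    simp only [h1, Finset.sum_add_distrib, Finset.sum_sub_distrib, h2, hE1, hW1]
    ring
  rw [hsum]
  calc (∑ x, φ x * T x) ^ 2 ≤ (∑ x, W x) * ∑ x, T x ^ 2 / W x := by
        refine Finset.sum_sq_le_sum_mul_sum_of_sq_le_mul _ (fun x _ => (hWpos x).le)
          (fun x _ => div_nonneg (sq_nonneg _) (hWpos x).le) fun x _ => ?_
        rw [mul_div_cancel₀ _ (hWpos x).ne', mul_pow]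
        have : φ x ^ 2 ≤ 1 := (sq_le_one_iff_abs_le_one _).2 (hφ x)
        nlinarith [sq_nonneg (T x)]
    _ = ∑ a, ∑ a', σ a * σ a' * ((∑ x, D a x * D a' x / D₀ x) ^ k - 1) := by
        rw [hW1, one_mul]
        have hsq : ∀ x, T x ^ 2 / W x = ∑ a, ∑ a', σ a * σ a' *
            ((E a x - W x) * (E a' x - W x) / W x) := fun x => by
          rw [hT, sq, Finset.sum_mul_sum, Finset.sum_div]
          refine Finset.sum_congr rfl fun a _ => ?_
          rw [Finset.sum_div]
          exact Finset.sum_congr rfl fun a' _ => by ring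
        simp only [← hcross, hsq, Finset.mul_sum]
        rw [Finset.sum_comm]
        refine Finset.sum_congr rfl fun a _ => ?_
        rw [Finset.sum_comm]
    _ ≤ ∑ a, ∑ a', |(∑ x, D a x * D a' x / D₀ x) ^ k - 1| := by
        refine Finset.sum_le_sum fun a _ => Finset.sum_le_sum fun a' _ => ?_
        refine (le_abs_self _).trans (le_of_eq ?_)
        rw [abs_mul, abs_mul, hσ1, hσ1, one_mul, one_mul]

end SecondMoment

section HyperplaneDistributions

lemma sum_fin_succ {α : Type} [Fintype α] {m : ℕ} (F : (Fin (m + 1) → α) → ℝ) :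
    ∑ z, F z = ∑ y : Fin m → α, ∑ s : α, F (Fin.snoc y s) := by
  rw [← (Fin.snocEquiv fun _ => α).sum_comp, Fintype.sum_prod_type_right]
  rfl

variable {p n : ℕ}

open Classical in
/-- The real `0/1` indicator of `hyp a`. -/
def hypInd (a z : Fin (n + 1) → ZMod p) : ℝ := if z ∈ hyp a then 1 else 0

lemma hypInd_nonneg (a z : Fin (n + 1) → ZMod p) : 0 ≤ hypInd a z := by
  unfold hypInd
  split_ifs <;> norm_num

lemma hypInd_le_one (a z : Fin (n + 1) → ZMod p) : hypInd a z ≤ 1 := by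
  unfold hypInd
  split_ifs <;> norm_num

variable [Fact p.Prime]

lemma hypInd_snoc [DecidableEq (ZMod p)] (a : Fin (n + 1) → ZMod p) (y : Fin n → ZMod p)
    (s : ZMod p) :
    hypInd a (Fin.snoc y s : Fin (n + 1) → ZMod p) =
      if s = ∑ i : Fin n, a i.castSucc * y i + a (Fin.last n) then 1 else 0 := by
  simp [hypInd, hyp]

lemma sum_hypInd_mul_hypInd (a a' : Fin (n + 1) → ZMod p) :
    ∑ z, hypInd a z * hypInd a' z =
      (Finset.univ.filter fun y : Fin n → ZMod p =>
        ∑ i : Fin n, (a i.castSucc - a' i.castSucc) * y i =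
          a' (Fin.last n) - a (Fin.last n)).card := by
  classical
  rw [sum_fin_succ, Finset.card_filter, Nat.cast_sum]
  refine Finset.sum_congr rfl fun y _ => ?_
  simp only [hypInd_snoc, ite_mul, one_mul, zero_mul, Finset.sum_ite_eq',
    Finset.mem_univ, if_true, sub_mul, Finset.sum_sub_distrib, Nat.cast_ite, Nat.cast_one,
    Nat.cast_zero]
  refine if_congr ?_ rfl rfl
  rw [sub_eq_sub_iff_add_eq_add, add_comm (a' _)]

lemma sum_hypInd (a : Fin (n + 1) → ZMod p) : ∑ z, hypInd a z = (p : ℝ) ^ n := by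
  have h := sum_hypInd_mul_hypInd a a
  have h2 : ∀ z, hypInd a z * hypInd a z = hypInd a z := fun z => by
    unfold hypInd
    split_ifs <;> simp
  simp only [h2] at h
  rw [h]
  simp [ZMod.card]

/-- Two non-parallel hyperplanes meet in a set of codimension two. -/
lemma mul_sum_hypInd_mul_hypInd_of_ne {a a' : Fin (n + 1) → ZMod p} {i₀ : Fin n}
    (h : a i₀.castSucc ≠ a' i₀.castSucc) :
    (p : ℝ) * ∑ z, hypInd a z * hypInd a' z = (p : ℝ) ^ n := by
  classical
  rw [sum_hypInd_mul_hypInd]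
  let ψ : (Fin n → ZMod p) →+ ZMod p :=
    { toFun := fun y => ∑ i : Fin n, (a i.castSucc - a' i.castSucc) * y i
      map_zero' := by simp
      map_add' := fun y y' => by simp [mul_add, Finset.sum_add_distrib] }
  have hsurj : ∀ s, s ∈ Set.range ψ := fun s => by
    refine ⟨Pi.single i₀ ((a i₀.castSucc - a' i₀.castSucc)⁻¹ * s), ?_⟩
    change ∑ i : Fin n, _ = _
    rw [Finset.sum_eq_single i₀]
    · rw [Pi.single_eq_same, mul_inv_cancel_left₀ (sub_ne_zero.2 h)]
    · intro i _ hi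
      rw [Pi.single_eq_of_ne hi, mul_zero]
    · simp
  have hfib := Finset.card_eq_sum_card_fiberwise (f := ψ) (s := Finset.univ) (t := Finset.univ)
    (fun _ _ => Finset.mem_coe.2 (Finset.mem_univ _))
  have hc : ∀ s : ZMod p, (Finset.univ.filter fun y => ψ y = s).card =
      (Finset.univ.filter fun y => ψ y = a' (Fin.last n) - a (Fin.last n)).card := fun s =>
    AddMonoidHom.card_fiber_eq_of_mem_range ψ (hsurj _) (hsurj _)
  simp only [hc, Finset.sum_const, Finset.card_univ, ZMod.card, Fintype.card_fun, Fintype.card_fin,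
    smul_eq_mul] at hfib
  exact_mod_cast hfib.symm

lemma sum_hypInd_mul_hypInd_of_parallel {a a' : Fin (n + 1) → ZMod p}
    (h : ∀ i : Fin n, a i.castSucc = a' i.castSucc) (hne : a ≠ a') :
    ∑ z, hypInd a z * hypInd a' z = 0 := by
  rw [sum_hypInd_mul_hypInd]
  have : a' (Fin.last n) - a (Fin.last n) ≠ 0 := by
    intro h0
    refine hne (funext fun i => ?_)
    refine Fin.lastCases ?_ h i
    exact (sub_eq_zero.1 h0).symm
  simp [h, this.symm]

/-- Half of the mass spread over `hyp a`, half over its complement. -/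
def hypWeight (a z : Fin (n + 1) → ZMod p) : ℝ :=
  hypInd a z / (2 * (p : ℝ) ^ n) + (1 - hypInd a z) / (2 * (p : ℝ) ^ n * (p - 1))

lemma one_lt_cast_prime (p : ℕ) [hp : Fact p.Prime] : (1 : ℝ) < p := by
  exact_mod_cast hp.out.one_lt

lemma two_le_cast_prime (p : ℕ) [hp : Fact p.Prime] : (2 : ℝ) ≤ p := by
  exact_mod_cast hp.out.two_le

lemma hypWeight_nonneg (a z : Fin (n + 1) → ZMod p) : 0 ≤ hypWeight a z := by
  have h1 := sub_pos.2 (one_lt_cast_prime p)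
  have h2 := hypInd_nonneg a z
  have h3 := sub_nonneg.2 (hypInd_le_one a z)
  have h4 : (0 : ℝ) < p := by linarith
  unfold hypWeight
  positivity

lemma sum_hypWeight (a : Fin (n + 1) → ZMod p) : ∑ z, hypWeight a z = 1 := by
  have h1 := sub_pos.2 (one_lt_cast_prime p)
  have h4 : (0 : ℝ) < p := by linarith
  simp only [hypWeight, Finset.sum_add_distrib, ← Finset.sum_div, Finset.sum_sub_distrib,
    sum_hypInd]
  simp only [Finset.sum_const, Finset.card_univ, Fintype.card_fun, ZMod.card, Fintype.card_fin,
    nsmul_eq_mul, mul_one, Nat.cast_pow]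
  field_simp
  ring

/-- The distribution with weights `hypWeight a`. -/
def hypDist (a : Fin (n + 1) → ZMod p) : PMF (Fin (n + 1) → ZMod p) :=
  PMF.ofFintype (fun z => ENNReal.ofReal (hypWeight a z)) (by
    rw [← ENNReal.ofReal_sum_of_nonneg fun z _ => hypWeight_nonneg a z, sum_hypWeight,
      ENNReal.ofReal_one])

lemma hypDist_toReal (a z : Fin (n + 1) → ZMod p) : (hypDist a z).toReal = hypWeight a z := by
  simp [hypDist, ENNReal.toReal_ofReal (hypWeight_nonneg a z)]

/-- The distribution of examples labeled by the hyperplane `a`. -/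
def hypLabeled (a : Fin (n + 1) → ZMod p) : PMF ((Fin (n + 1) → ZMod p) × ℤˣ) :=
  labeled (hypDist a) (hypFun a)

lemma hypLabeled_one (a z : Fin (n + 1) → ZMod p) :
    (hypLabeled a (z, 1)).toReal = hypInd a z / (2 * (p : ℝ) ^ n) := by
  rw [hypLabeled, labeled_apply_toReal, hypDist_toReal]
  unfold hypWeight hypInd hypFun
  split_ifs <;> simp_all

lemma hypLabeled_neg_one (a z : Fin (n + 1) → ZMod p) :
    (hypLabeled a (z, -1)).toReal = (1 - hypInd a z) / (2 * (p : ℝ) ^ n * (p - 1)) := by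
  rw [hypLabeled, labeled_apply_toReal, hypDist_toReal]
  unfold hypWeight hypInd hypFun
  split_ifs <;> simp_all

/-- The weight of a point of `𝔽_p^(n+1) × {±1}` under the uniform distribution. -/
def refWeight (p n : ℕ) : ℝ := 1 / (2 * (p : ℝ) ^ (n + 1))

lemma hypLabeled_correlation (a a' : Fin (n + 1) → ZMod p) :
    ∑ x, (hypLabeled a x).toReal * (hypLabeled a' x).toReal / refWeight p n =
      (∑ z, hypInd a z * hypInd a' z) * p / (2 * (p : ℝ) ^ n) +
        ((p : ℝ) ^ (n + 1) - 2 * (p : ℝ) ^ n + ∑ z, hypInd a z * hypInd a' z) * p /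
          (2 * (p : ℝ) ^ n * (p - 1) ^ 2) := by
  have h1 := sub_pos.2 (one_lt_cast_prime p)
  have h4 : (0 : ℝ) < p := by linarith
  have hcomp : ∑ z, (1 - hypInd a z) * (1 - hypInd a' z) =
      (p : ℝ) ^ (n + 1) - 2 * (p : ℝ) ^ n + ∑ z, hypInd a z * hypInd a' z := by
    have : ∀ z, (1 - hypInd a z) * (1 - hypInd a' z) =
      1 - hypInd a z - hypInd a' z + hypInd a z * hypInd a' z := fun z => by ring
    simp only [this, Finset.sum_add_distrib, Finset.sum_sub_distrib, sum_hypInd]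
    simp only [Finset.sum_const, Finset.card_univ, Fintype.card_fun, ZMod.card, Fintype.card_fin,
      nsmul_eq_mul, mul_one, Nat.cast_pow]
    ring
  have hz : ∀ z, ∑ b : ℤˣ,
      (hypLabeled a (z, b)).toReal * (hypLabeled a' (z, b)).toReal / refWeight p n =
      hypInd a z * hypInd a' z * (p / (2 * (p : ℝ) ^ n)) +
        (1 - hypInd a z) * (1 - hypInd a' z) * (p / (2 * (p : ℝ) ^ n * (p - 1) ^ 2)) := by
    intro z
    rw [UnitsInt.univ, Finset.sum_pair (by decide)]
    simp only [hypLabeled_one, hypLabeled_neg_one, refWeight]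
    field_simp
    ring
  rw [Fintype.sum_prod_type]
  simp only [hz, Finset.sum_add_distrib, ← Finset.sum_mul, hcomp]
  ring

lemma abs_correlation_pow_sub_one_le [DecidableEq (ZMod p)] (k : ℕ) (a a' : Fin (n + 1) → ZMod p) :
    |(∑ x, (hypLabeled a x).toReal * (hypLabeled a' x).toReal / refWeight p n) ^ k - 1| ≤
      (if a = a' then (p : ℝ) ^ k else 0) +
        (if ∀ i : Fin n, a i.castSucc = a' i.castSucc then 1 else 0) := by
  have h1 := sub_pos.2 (one_lt_cast_prime p)
  have h2 := two_le_cast_prime p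
  have h4 : (0 : ℝ) < p := by linarith
  rw [hypLabeled_correlation]
  by_cases hpar : ∀ i : Fin n, a i.castSucc = a' i.castSucc
  · by_cases haa : a = a'
    · subst haa
      have hI : ∑ z, hypInd a z * hypInd a z = (p : ℝ) ^ n := by
        rw [← sum_hypInd a]
        refine Finset.sum_congr rfl fun z _ => ?_
        unfold hypInd
        split_ifs <;> simp
      rw [hI]
      have hG : (p : ℝ) ^ n * p / (2 * (p : ℝ) ^ n) +
          ((p : ℝ) ^ (n + 1) - 2 * (p : ℝ) ^ n + (p : ℝ) ^ n) * p /
            (2 * (p : ℝ) ^ n * (p - 1) ^ 2) = (p : ℝ) ^ 2 / (2 * (p - 1)) := by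
        field_simp
        ring
      rw [hG]
      have hG0 : 0 ≤ (p : ℝ) ^ 2 / (2 * (p - 1)) := by positivity
      have hG1 : (p : ℝ) ^ 2 / (2 * (p - 1)) ≤ p := by
        rw [div_le_iff₀ (by positivity)]
        nlinarith
      have hGk := pow_le_pow_left₀ hG0 hG1 k
      have hG0k := pow_nonneg hG0 k
      have : (0 : ℝ) ≤ (p : ℝ) ^ k := by positivity
      simp only [if_true, implies_true]
      rw [abs_le]
      constructor <;> linarith
    · rw [sum_hypInd_mul_hypInd_of_parallel hpar haa]
      have hG : 0 * (p : ℝ) / (2 * (p : ℝ) ^ n) +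
          ((p : ℝ) ^ (n + 1) - 2 * (p : ℝ) ^ n + 0) * p /
            (2 * (p : ℝ) ^ n * (p - 1) ^ 2) = p * (p - 2) / (2 * (p - 1) ^ 2) := by
        field_simp
        ring
      rw [hG]
      have hG0 : 0 ≤ (p : ℝ) * (p - 2) / (2 * (p - 1) ^ 2) := by
        have := sub_nonneg.2 h2
        positivity
      have hG1 : (p : ℝ) * (p - 2) / (2 * (p - 1) ^ 2) ≤ 1 := by
        rw [div_le_iff₀ (by positivity)]
        nlinarith
      have hGk := pow_le_one₀ hG0 hG1 (n := k)
      have hG0k := pow_nonneg hG0 k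
      rw [if_neg haa, if_pos hpar, abs_le]
      constructor <;> linarith
  · have haa : a ≠ a' := fun h => hpar fun i => by rw [h]
    rw [if_neg haa, if_neg hpar]
    push Not at hpar
    obtain ⟨i, hi⟩ := hpar
    have hI : ∑ z, hypInd a z * hypInd a' z = (p : ℝ) ^ n / p := by
      rw [eq_div_iff h4.ne', mul_comm]
      exact mul_sum_hypInd_mul_hypInd_of_ne hi
    rw [hI]
    have hG : (p : ℝ) ^ n / p * (p : ℝ) / (2 * (p : ℝ) ^ n) +
        ((p : ℝ) ^ (n + 1) - 2 * (p : ℝ) ^ n + (p : ℝ) ^ n / p) * p /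
          (2 * (p : ℝ) ^ n * (p - 1) ^ 2) = 1 := by
      field_simp
      ring
    rw [hG]
    simp

/-- The value of a query at the uniform distribution on `𝔽_p^(n+1) × {±1}`. -/
def refExpect {k : ℕ} (φ : (Fin k → (Fin (n + 1) → ZMod p) × ℤˣ) → ℝ) : ℝ :=
  ∑ x : Fin k → (Fin (n + 1) → ZMod p) × ℤˣ, (∏ _i : Fin k, refWeight p n) * φ x

lemma sum_refWeight :
    ∑ _x : (Fin (n + 1) → ZMod p) × ℤˣ, refWeight p n = 1 := by
  have h4 : (0 : ℝ) < p := by linarith [one_lt_cast_prime p]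
  simp only [Finset.sum_const, Finset.card_univ, Fintype.card_prod, Fintype.card_fun, ZMod.card,
    Fintype.card_fin, Fintype.card_units_int, nsmul_eq_mul, refWeight]
  push_cast
  field_simp

lemma sq_sum_abs_hypLabeled_le {k : ℕ} (hk : 1 ≤ k)
    {φ : (Fin k → (Fin (n + 1) → ZMod p) × ℤˣ) → ℝ} (hφ : ∀ x, |φ x| ≤ 1) :
    (∑ a : Fin (n + 1) → ZMod p, |expect (hypLabeled a) φ - refExpect φ|) ^ 2 ≤
      2 * (p : ℝ) ^ (n + 1 + k) := by
  classical
  have h1 := one_lt_cast_prime p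
  have h4 : (0 : ℝ) < p := by linarith
  refine (sq_sum_abs_sub_le (D := fun (a : Fin (n + 1) → ZMod p) x => (hypLabeled a x).toReal)
    (D₀ := fun _ => refWeight p n) (fun _ => by unfold refWeight; positivity) sum_refWeight
    (fun a => sum_toReal_eq_one _) hφ).trans ?_
  have hrow : ∀ a : Fin (n + 1) → ZMod p, ∑ a' : Fin (n + 1) → ZMod p,
      ((if a = a' then (p : ℝ) ^ k else 0) +
        (if ∀ i : Fin n, a i.castSucc = a' i.castSucc then 1 else 0)) ≤ 2 * (p : ℝ) ^ k := by
    intro a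
    rw [Finset.sum_add_distrib, Finset.sum_ite_eq, if_pos (Finset.mem_univ _), sum_fin_succ]
    have h5 : ∀ (y : Fin n → ZMod p) (s : ZMod p),
        (if ∀ i : Fin n, a i.castSucc = (Fin.snoc y s : Fin (n + 1) → ZMod p) i.castSucc
          then (1 : ℝ) else 0) = if (fun i : Fin n => a i.castSucc) = y then 1 else 0 := by
      intro y s
      simp [funext_iff]
    simp only [h5, Finset.sum_const, Finset.card_univ, ZMod.card, nsmul_eq_mul, mul_ite, mul_one,
      mul_zero, Finset.sum_ite_eq, Finset.mem_univ, if_true]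
    have : (p : ℝ) ≤ (p : ℝ) ^ k := le_self_pow₀ h1.le (by omega)
    linarith
  calc _ ≤ ∑ a : Fin (n + 1) → ZMod p, ∑ a' : Fin (n + 1) → ZMod p,
      ((if a = a' then (p : ℝ) ^ k else 0) +
        (if ∀ i : Fin n, a i.castSucc = a' i.castSucc then (1 : ℝ) else 0)) :=
        Finset.sum_le_sum fun a _ => Finset.sum_le_sum fun a' _ =>
          abs_correlation_pow_sub_one_le k a a'
    _ ≤ ∑ _a : Fin (n + 1) → ZMod p, 2 * (p : ℝ) ^ k := Finset.sum_le_sum fun a _ => hrow a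
    _ = 2 * (p : ℝ) ^ (n + 1 + k) := by
      simp only [Finset.sum_const, Finset.card_univ, Fintype.card_fun, ZMod.card, Fintype.card_fin,
        nsmul_eq_mul, Nat.cast_pow]
      ring

end HyperplaneDistributions

section Adversary

/-- If the answers agree with those of a reference oracle on a short list of queries, then the
output of an algorithm asking few queries is determined. -/
lemma SQAlg.exists_transcript {k : ℕ} {X H : Type} (O₀ : Query k X → ℝ) (q : ℕ)
    (A : SQAlg k X H) :
    ∃ (l : List (Query k X)) (h : H), l.length ≤ q ∧ ∀ O : Query k X → ℝ,
      (∀ φ ∈ l, O φ = O₀ φ) → A.numQueries O ≤ q → A.run O = h := by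
  induction q generalizing A with
  | zero =>
    refine ⟨[], A.run O₀, le_rfl, fun O _ hO => ?_⟩
    cases A with
    | output h => rfl
    | query φ next => simp [SQAlg.numQueries] at hO
  | succ q ih =>
    cases A with
    | output h => exact ⟨[], h, Nat.zero_le _, fun _ _ _ => rfl⟩
    | query φ next =>
      obtain ⟨l, h, hl, hrun⟩ := ih (next (O₀ φ))
      refine ⟨φ :: l, h, Nat.succ_le_succ hl, fun O hO hq => ?_⟩
      have hφ : O φ = O₀ φ := hO φ List.mem_cons_self
      rw [SQAlg.numQueries, hφ] at hq
      rw [SQAlg.run, hφ]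
      exact hrun O (fun ψ hψ => hO ψ (List.mem_cons_of_mem _ hψ)) (Nat.le_of_succ_le_succ hq)

open Classical in
/-- Averaging over finitely many events, which need not be measurable. -/
lemma le_card_mul_of_forall_le_card {Ω ι : Type} [Fintype ι] [MeasurableSpace Ω]
    (μ : MeasureTheory.Measure Ω) [MeasureTheory.IsProbabilityMeasure μ] (F : ι → Set Ω)
    {δ M : ℝ} (hδ : 0 ≤ δ) (hF : ∀ a, μ (F a) ≤ ENNReal.ofReal δ)
    (hM : ∀ ω, M ≤ (Finset.univ.filter fun a => ω ∈ F a).card) :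
    M ≤ Fintype.card ι * δ := by
  have h1 : ENNReal.ofReal M ≤ ∑ a, μ (F a) := by
    calc ENNReal.ofReal M = ∫⁻ _ω, ENNReal.ofReal M ∂μ := by simp
      _ ≤ ∫⁻ ω, ∑ a, (MeasureTheory.toMeasurable μ (F a)).indicator 1 ω ∂μ := by
        refine MeasureTheory.lintegral_mono fun ω => ?_
        refine (ENNReal.ofReal_le_ofReal (hM ω)).trans ?_
        rw [ENNReal.ofReal_natCast, Finset.card_filter, Nat.cast_sum]
        refine Finset.sum_le_sum fun a _ => ?_
        by_cases ha : ω ∈ F a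
        · rw [Set.indicator_of_mem (MeasureTheory.subset_toMeasurable μ _ ha)]
          simp [ha]
        · simp [ha]
      _ = ∑ a, μ (F a) := by
        rw [MeasureTheory.lintegral_finsetSum _ fun a _ =>
          measurable_one.indicator (MeasureTheory.measurableSet_toMeasurable μ _)]
        refine Finset.sum_congr rfl fun a _ => ?_
        rw [MeasureTheory.lintegral_indicator_one (MeasureTheory.measurableSet_toMeasurable μ _),
          MeasureTheory.measure_toMeasurable]
  have h2 : ENNReal.ofReal M ≤ ENNReal.ofReal (Fintype.card ι * δ) := by
    refine h1.trans ((Finset.sum_le_sum fun a _ => hF a).trans (le_of_eq ?_))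
    rw [Finset.sum_const, Finset.card_univ, nsmul_eq_mul, ENNReal.ofReal_mul (Nat.cast_nonneg _),
      ENNReal.ofReal_natCast]
  exact (ENNReal.ofReal_le_ofReal_iff (by positivity)).1 h2

lemma isSTAT_expect {X : Type} [Fintype X] {k : ℕ} (D : PMF X) {τ : ℝ} (hτ : 0 ≤ τ) :
    IsSTAT (k := k) D τ fun φ => expect D fun x => (φ x : ℝ) := fun φ => by
  simpa using hτ

lemma abs_query_le_one {X : Type} {k : ℕ} (φ : Query k X) (x : Fin k → X) :
    |(φ x : ℝ)| ≤ 1 :=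
  abs_le.2 (φ x).2

lemma units_mul_mem_Icc (b c : ℤˣ) : (((b * c : ℤˣ) : ℤ) : ℝ) ∈ Set.Icc (-1 : ℝ) 1 := by
  rcases Int.units_eq_one_or (b * c) with h | h <;> simp [h]

/-- The query measuring the correlation of the label with a hypothesis. -/
def corrQuery {Z : Type} {k : ℕ} (hk : 1 ≤ k) (h : Z → ℤˣ) : Query k (Z × ℤˣ) := fun x =>
  ⟨(((x (Fin.castLE hk 0)).2 * h (x (Fin.castLE hk 0)).1 : ℤˣ) : ℤ), units_mul_mem_Icc _ _⟩

lemma sum_fin_one {X : Type} [Fintype X] (F : (Fin 1 → X) → ℝ) :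
    ∑ y, F y = ∑ x, F fun _ => x :=
  ((Equiv.funUnique (Fin 1) X).symm.sum_comp F).symm

lemma expect_corrQuery {Z : Type} [Fintype Z] {k : ℕ} (hk : 1 ≤ k) (P : PMF Z) (f h : Z → ℤˣ) :
    expect (labeled P f) (fun x => (corrQuery hk h x : ℝ)) = 1 - 2 * err P f h := by
  rw [expect_labeled]
  have hm := sum_prod_mul_castLE (sum_toReal_eq_one P) hk
    fun y => (((f (y 0) * h (y 0) : ℤˣ) : ℤ) : ℝ)
  refine hm.trans ?_
  rw [sum_fin_one, err, Finset.sum_filter, ← sum_toReal_eq_one P, Finset.mul_sum,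
    ← Finset.sum_sub_distrib]
  refine Finset.sum_congr rfl fun z _ => ?_
  rcases Int.units_eq_one_or (f z) with h1 | h1 <;>
    rcases Int.units_eq_one_or (h z) with h2 | h2 <;> simp [h1, h2] <;> ring

variable {p n : ℕ} [Fact p.Prime]

lemma refExpect_corrQuery {k : ℕ} (hk : 1 ≤ k) (h : (Fin (n + 1) → ZMod p) → ℤˣ) :
    refExpect (fun x => (corrQuery hk h x : ℝ)) = 0 := by
  have hm := sum_prod_mul_castLE (w := fun _ => refWeight p n) sum_refWeight hk
    fun y : Fin 1 → (Fin (n + 1) → ZMod p) × ℤˣ => ((((y 0).2 * h (y 0).1 : ℤˣ) : ℤ) : ℝ)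
  refine hm.trans ?_
  rw [sum_fin_one, Fintype.sum_prod_type]
  refine Finset.sum_eq_zero fun z _ => ?_
  rw [UnitsInt.univ, Finset.sum_pair (by decide)]
  simp

open Classical in
/-- The hyperplanes for which the query `φ` deviates from its reference value by more
than `τ`. -/
def deviating {k : ℕ} (τ : ℝ) (φ : Query k ((Fin (n + 1) → ZMod p) × ℤˣ)) :
    Finset (Fin (n + 1) → ZMod p) :=
  Finset.univ.filter fun a =>
    τ < |expect (hypLabeled a) (fun x => (φ x : ℝ)) - refExpect fun x => (φ x : ℝ)|

lemma card_deviating_mul_sq_le {k : ℕ} (hk : 1 ≤ k) {τ : ℝ} (hτ : 0 ≤ τ)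
    (φ : Query k ((Fin (n + 1) → ZMod p) × ℤˣ)) :
    ((deviating τ φ).card * τ) ^ 2 ≤ 2 * (p : ℝ) ^ (n + 1 + k) := by
  refine le_trans (pow_le_pow_left₀ (by positivity) ?_ 2)
    (sq_sum_abs_hypLabeled_le hk (abs_query_le_one φ))
  rw [← nsmul_eq_mul]
  refine (Finset.card_nsmul_le_sum (deviating τ φ) _ τ fun a ha => ?_).trans
    (Finset.sum_le_sum_of_subset_of_nonneg (Finset.subset_univ _) fun _ _ _ => abs_nonneg _)
  exact (Finset.mem_filter.1 ha).2.le

/-- If all deviating sets are small, learning takes many queries. -/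
lemma randLearnable_deviating_bound {k q : ℕ} (hk : 1 ≤ k) {t δ B : ℝ} (ht : 0 < t) (hδ : 0 ≤ δ)
    (hB : ∀ φ : Query k ((Fin (n + 1) → ZMod p) × ℤˣ), ((deviating (1 / t) φ).card : ℝ) ≤ B)
    (h : RandLearnable k (hypClass p n) (1 / 2 - 2 / t) δ (1 / t) q) :
    (p : ℝ) ^ (n + 1) - (q + 1) * B ≤ (p : ℝ) ^ (n + 1) * δ := by
  classical
  obtain ⟨Ω, _, μ, _, A, hA⟩ := h
  have hτ : 0 < 1 / t := by positivity
  let O : (Fin (n + 1) → ZMod p) → Query k ((Fin (n + 1) → ZMod p) × ℤˣ) → ℝ := fun a φ =>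
    if a ∈ deviating (1 / t) φ then expect (hypLabeled a) fun x => (φ x : ℝ)
    else refExpect fun x => (φ x : ℝ)
  have hO : ∀ a, IsSTAT (labeled (hypDist a) (hypFun a)) (1 / t) (O a) := by
    intro a φ
    change |O a φ - expect (hypLabeled a) _| ≤ 1 / t
    by_cases ha : a ∈ deviating (1 / t) φ
    · simp only [O, if_pos ha, sub_self, abs_zero]
      exact hτ.le
    · simp only [O, if_neg ha]
      rw [abs_sub_comm]
      simpa [deviating] using ha
  have hA' := fun a => hA (hypDist a) (hypFun a) ⟨a, rfl⟩ (O a) (hO a)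
  have hcard : ((Fintype.card (Fin (n + 1) → ZMod p) : ℕ) : ℝ) = (p : ℝ) ^ (n + 1) := by
    simp [ZMod.card]
  rw [← hcard]
  refine le_card_mul_of_forall_le_card μ _ hδ (fun a => (hA' a).2) fun ω => ?_
  obtain ⟨l, h, hl, hrun⟩ := (A ω).exists_transcript (fun φ => refExpect fun x => (φ x : ℝ)) q
  have hcover : (Finset.univ : Finset (Fin (n + 1) → ZMod p)) ⊆
      (Finset.univ.filter fun a => ω ∈ {ω | 1 / 2 - 2 / t <
        err (hypDist a) (hypFun a) ((A ω).run (O a))}) ∪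
      (corrQuery hk h :: l).toFinset.biUnion (deviating (1 / t)) := by
    intro a _
    rw [Finset.mem_union]
    refine or_iff_not_imp_right.2 fun hno => ?_
    have hno' : ∀ φ ∈ corrQuery hk h :: l, a ∉ deviating (1 / t) φ := by
      intro φ hφ ha
      exact hno (Finset.mem_biUnion.2 ⟨φ, List.mem_toFinset.2 hφ, ha⟩)
    have hout : (A ω).run (O a) = h := by
      refine hrun (O a) (fun φ hφ => ?_) ((hA' a).1 ω)
      simp only [O, if_neg (hno' φ (List.mem_cons_of_mem _ hφ))]
    have hc := hno' _ List.mem_cons_self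
    simp only [deviating, Finset.mem_filter, Finset.mem_univ, true_and, not_lt, hypLabeled,
      expect_corrQuery, refExpect_corrQuery, sub_zero] at hc
    have hc' := (abs_le.1 hc).2
    simp only [Finset.mem_filter, Finset.mem_univ, true_and, Set.mem_ofPred_eq, hout]
    have : 2 / t = 2 * (1 / t) := by ring
    linarith
  have h1 := (Finset.card_le_card hcover).trans (Finset.card_union_le _ _)
  have h2 : ((((corrQuery hk h :: l).toFinset.biUnion (deviating (1 / t))).card : ℕ) : ℝ) ≤
      (q + 1) * B := by
    have hB0 : 0 ≤ B := (Nat.cast_nonneg _).trans (hB (corrQuery hk h))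
    calc ((((corrQuery hk h :: l).toFinset.biUnion (deviating (1 / t))).card : ℕ) : ℝ)
        ≤ ∑ φ ∈ (corrQuery hk h :: l).toFinset, ((deviating (1 / t) φ).card : ℝ) := by
          exact_mod_cast Finset.card_biUnion_le
      _ ≤ ∑ _φ ∈ (corrQuery hk h :: l).toFinset, B := Finset.sum_le_sum fun φ _ => hB φ
      _ = (corrQuery hk h :: l).toFinset.card * B := by rw [Finset.sum_const, nsmul_eq_mul]
      _ ≤ (q + 1) * B := by
          refine mul_le_mul_of_nonneg_right ?_ hB0
          exact_mod_cast (List.toFinset_card_le _).trans (Nat.succ_le_succ hl)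
  rw [Finset.card_univ] at h1
  have h3 : ((Fintype.card (Fin (n + 1) → ZMod p) : ℕ) : ℝ) ≤ _ := Nat.cast_le.2 h1
  rw [Nat.cast_add] at h3
  linarith

/-- The lower bound for `k`-wise queries. -/
theorem hypClass_lower_bound {δ : ℝ} (hδ : 0 ≤ δ) (hδ1 : δ < 1) :
    ∃ c : ℝ, 0 < c ∧ ∀ (p : ℕ) [Fact p.Prime] (k n : ℕ), 1 ≤ k →
      ∃ t : ℝ, c * (p : ℝ) ^ ((((n + 1 : ℕ) : ℝ) - (k : ℝ)) / 4) ≤ t ∧ 0 < t ∧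
        ∀ q : ℕ, RandLearnable k (hypClass p n) (1 / 2 - 2 / t) δ (1 / t) q → t ≤ q := by
  have h1δ : 0 < 1 - δ := by linarith
  set c := √(1 - δ) / 4 with hc
  have hc0 : 0 < c := by positivity
  have hc2 : c ^ 2 = (1 - δ) / 16 := by
    rw [hc, div_pow, Real.sq_sqrt h1δ.le]
    norm_num
  refine ⟨c, hc0, fun p hp k n hk => ?_⟩
  have hp0 : (0 : ℝ) < p := by linarith [one_lt_cast_prime p]
  set t := c * (p : ℝ) ^ ((((n + 1 : ℕ) : ℝ) - (k : ℝ)) / 4) with ht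
  have ht0 : 0 < t := by positivity
  refine ⟨t, le_rfl, ht0, fun q hq => ?_⟩
  by_contra! hqt
  rcases lt_or_ge t 4 with ht4 | ht4
  · obtain ⟨Ω, _, μ, _, A, hA⟩ := hq
    have h := (hA (hypDist 0) (hypFun 0) ⟨0, rfl⟩ _ (isSTAT_expect _ (by positivity))).2
    have hneg : 1 / 2 - 2 / t < 0 := by
      rw [sub_neg, div_lt_div_iff₀ (by norm_num) ht0]
      linarith
    have huniv : ∀ A' : Ω → (Fin (n + 1) → ZMod p) → ℤˣ,
        {ω | 1 / 2 - 2 / t < err (hypDist 0) (hypFun 0) (A' ω)} = Set.univ := fun A' =>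
      Set.eq_univ_of_forall fun ω => hneg.trans_le (err_nonneg _ _ _)
    rw [huniv, MeasureTheory.measure_univ, ENNReal.one_le_ofReal] at h
    linarith
  · have ht4' : t ^ 4 * (p : ℝ) ^ (n + 1 + k) = c ^ 4 * ((p : ℝ) ^ (n + 1)) ^ 2 := by
      have hr : ((p : ℝ) ^ ((((n + 1 : ℕ) : ℝ) - (k : ℝ)) / 4)) ^ 4 =
          (p : ℝ) ^ (((n + 1 : ℕ) : ℝ) - (k : ℝ)) := by
        rw [← Real.rpow_mul_natCast hp0.le]
        congr 1
        push_cast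
        ring
      rw [ht, mul_pow, hr, Real.rpow_sub hp0, Real.rpow_natCast, Real.rpow_natCast]
      field_simp
      ring
    have hB : ∀ φ : Query k ((Fin (n + 1) → ZMod p) × ℤˣ),
        ((deviating (1 / t) φ).card : ℝ) ≤ 2 * c ^ 2 * (p : ℝ) ^ (n + 1) / t := by
      intro φ
      have h1 := card_deviating_mul_sq_le hk (τ := 1 / t) (by positivity) φ
      rw [le_div_iff₀ ht0]
      refine le_of_sq_le_sq ?_ (by positivity)
      have h2 : ((deviating (1 / t) φ).card * t : ℝ) ^ 2 =
          ((deviating (1 / t) φ).card * (1 / t)) ^ 2 * t ^ 4 := by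
        field_simp
      rw [h2]
      calc ((deviating (1 / t) φ).card * (1 / t)) ^ 2 * t ^ 4
          ≤ 2 * (p : ℝ) ^ (n + 1 + k) * t ^ 4 := by gcongr
        _ = 2 * (c ^ 4 * ((p : ℝ) ^ (n + 1)) ^ 2) := by rw [← ht4']; ring
        _ ≤ 4 * (c ^ 4 * ((p : ℝ) ^ (n + 1)) ^ 2) := by gcongr; norm_num
        _ = (2 * c ^ 2 * (p : ℝ) ^ (n + 1)) ^ 2 := by ring
    have hmain := randLearnable_deviating_bound hk ht0 hδ hB hq
    have hS : (0 : ℝ) < (p : ℝ) ^ (n + 1) := by positivity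
    have h5 : ((q : ℝ) + 1) * (2 * c ^ 2 * (p : ℝ) ^ (n + 1) / t) ≤
        4 * c ^ 2 * (p : ℝ) ^ (n + 1) := by
      have h6 : ((q : ℝ) + 1) ≤ 2 * t := by linarith
      calc ((q : ℝ) + 1) * (2 * c ^ 2 * (p : ℝ) ^ (n + 1) / t)
          ≤ 2 * t * (2 * c ^ 2 * (p : ℝ) ^ (n + 1) / t) := by gcongr
        _ = 4 * c ^ 2 * (p : ℝ) ^ (n + 1) := by
          field_simp
          ring
    rw [hc2] at h5 hmain
    nlinarith

end Adversary

section Separation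

variable {Z : Type} [Fintype Z] {k : ℕ} {C : Set (Z → ℤˣ)}

lemma RandLearnable.mono {ε ε' δ τ τ' : ℝ} {q : ℕ} (h : RandLearnable k C ε δ τ q)
    (hε : ε ≤ ε') (hτ : τ' ≤ τ) : RandLearnable k C ε' δ τ' q := by
  obtain ⟨Ω, m, μ, hμ, A, hA⟩ := h
  refine ⟨Ω, m, μ, hμ, A, fun P f hf O hO => ?_⟩
  have h1 := hA P f hf O fun φ => (hO φ).trans hτ
  exact ⟨h1.1, (MeasureTheory.measure_mono fun ω hω => hε.trans_lt hω).trans h1.2⟩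

lemma DetLearnable.randLearnable {ε τ : ℝ} {q : ℕ} (h : DetLearnable k C ε τ q) (δ : ℝ) :
    RandLearnable k C ε δ τ q := by
  obtain ⟨A, hA⟩ := h
  refine ⟨Unit, ⊤, MeasureTheory.Measure.dirac (), inferInstance, fun _ => A,
    fun P f hf O hO => ⟨fun _ => (hA P f hf O hO).1, ?_⟩⟩
  have : {_ω : Unit | ε < err P f (A.run O)} = ∅ :=
    Set.eq_empty_of_forall_notMem fun _ hω => not_lt.2 (hA P f hf O hO).2 hω
  rw [this, MeasureTheory.measure_empty]
  exact zero_le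

lemma sqComplexity_le {ε δ : ℝ} {m : ℕ} (hm : 0 < m)
    (h : RandLearnable k C ε δ (1 / (m : ℝ)) m) : sqComplexity k C ε δ ≤ m :=
  iInf₂_le m ⟨hm, h⟩

lemma le_sqComplexity {ε δ : ℝ} {b : ℝ}
    (h : ∀ m : ℕ, 0 < m → RandLearnable k C ε δ (1 / (m : ℝ)) m → b ≤ m) :
    ENNReal.ofReal b ≤ (sqComplexity k C ε δ : ENNReal) := by
  have h1 : ((⌈b⌉₊ : ℕ) : ℕ∞) ≤ sqComplexity k C ε δ :=
    le_iInf₂ fun m hm => by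
      exact_mod_cast Nat.ceil_le.2 (h m hm.1 hm.2)
  refine le_trans ?_ (ENat.toENNReal_le.2 h1)
  rw [ENat.toENNReal_coe, ← ENNReal.ofReal_natCast]
  exact ENNReal.ofReal_le_ofReal (Nat.le_ceil b)

lemma sqComplexity_hypClass_upper (k : ℕ) {ε : ℝ} (hε : 0 < ε) (hε1 : ε ≤ 1) (δ : ℝ) :
    ∃ c : ℝ, 0 < c ∧ ∀ (p : ℕ) [Fact p.Prime],
      (sqComplexity (k + 1) (hypClass p k) ε δ : ENNReal) ≤ ENNReal.ofReal (c * Real.log p) := by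
  obtain ⟨c, hc, h⟩ := hypClass_upper_bound k
  refine ⟨2 / ε ^ (k + 1) * c, by positivity, fun p hp => ?_⟩
  obtain ⟨t, ht1, htc, hlearn⟩ := h p
  have ht1' : (1 : ℝ) ≤ t := by exact_mod_cast ht1
  have hε' : 0 < ε ^ (k + 1) := by positivity
  have hε1' : ε ^ (k + 1) ≤ 1 := pow_le_one₀ hε.le hε1
  have hle : (t : ℝ) ≤ t / ε ^ (k + 1) := le_div_self (by linarith) hε' hε1'
  set m := ⌈(t : ℝ) / ε ^ (k + 1)⌉₊ with hm
  have hmge : (t : ℝ) / ε ^ (k + 1) ≤ m := Nat.le_ceil _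
  have htm : t ≤ m := by exact_mod_cast hle.trans hmge
  have hm0 : 0 < m := lt_of_lt_of_le ht1 htm
  have hrand := (((hlearn ε hε).mono htm).randLearnable δ).mono le_rfl
    (τ' := 1 / (m : ℝ)) (by
      rw [div_le_div_iff₀ (by positivity) (by positivity), one_mul, mul_comm]
      rwa [div_le_iff₀ hε'] at hmge)
  refine (ENat.toENNReal_le.2 (sqComplexity_le hm0 hrand)).trans ?_
  rw [ENat.toENNReal_coe, ← ENNReal.ofReal_natCast]
  refine ENNReal.ofReal_le_ofReal ?_
  have h1 : (m : ℝ) < t / ε ^ (k + 1) + 1 := Nat.ceil_lt_add_one (by positivity)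
  calc (m : ℝ) ≤ 2 / ε ^ (k + 1) * t := by
        have : 2 / ε ^ (k + 1) * t = t / ε ^ (k + 1) + t / ε ^ (k + 1) := by ring
        linarith
    _ ≤ 2 / ε ^ (k + 1) * (c * Real.log p) := by gcongr
    _ = 2 / ε ^ (k + 1) * c * Real.log p := by ring

lemma sqComplexity_hypClass_lower {ε δ : ℝ} (hε : ε < 1 / 2) (hδ : 0 ≤ δ) (hδ1 : δ < 1) :
    ∃ c : ℝ, 0 < c ∧ ∀ (p : ℕ) [Fact p.Prime] (k : ℕ), 1 ≤ k →
      ENNReal.ofReal (c * (p : ℝ) ^ (1 / 4 : ℝ)) ≤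
        (sqComplexity k (hypClass p k) ε δ : ENNReal) := by
  obtain ⟨c, hc, h⟩ := hypClass_lower_bound hδ hδ1
  set s := 2 / (1 / 2 - ε) with hs
  have hgap : 0 < 1 / 2 - ε := by linarith
  have hs0 : 0 < s := by positivity
  refine ⟨min c (c / s), by positivity, fun p hp k hk => le_sqComplexity fun m hm hlearn => ?_⟩
  obtain ⟨t, hct, ht0, ht⟩ := h p k k hk
  have hexp : (((k + 1 : ℕ) : ℝ) - (k : ℝ)) / 4 = 1 / 4 := by
    push_cast
    ring
  rw [hexp] at hct
  have hm1 : (1 : ℝ) ≤ m := by exact_mod_cast hm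
  have hp0 : (0 : ℝ) ≤ (p : ℝ) ^ (1 / 4 : ℝ) := by positivity
  rcases lt_or_ge t s with hts | hts
  · calc min c (c / s) * (p : ℝ) ^ (1 / 4 : ℝ) ≤ c / s * (p : ℝ) ^ (1 / 4 : ℝ) := by
          gcongr
          exact min_le_right _ _
      _ = c * (p : ℝ) ^ (1 / 4 : ℝ) / s := by ring
      _ ≤ 1 := (div_le_one hs0).2 (hct.trans hts.le)
      _ ≤ m := hm1
  · have htm : t ≤ m := by
      by_contra! hlt
      refine absurd (ht m (hlearn.mono ?_ ?_)) (not_le.2 hlt)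
      · have : 2 / t ≤ 1 / 2 - ε := by
          rw [hs, div_le_iff₀ hgap] at hts
          rw [div_le_iff₀ ht0]
          linarith
        linarith
      · exact one_div_le_one_div_of_le (by linarith) hlt.le
    refine le_trans ?_ (hct.trans htm)
    gcongr
    exact min_le_left _ _

end Separation

end KWiseSQ

end

open KWiseSQ in
/-- With `ℓ = n + 1`, `hypClass p n` is the class over `𝔽_p^ℓ`; `hypClass p k` is the class over
`𝔽_p^(k+1)`. The three parts are the upper bound for `(k+1)`-wise queries, the lower bound for
`k`-wise queries, and the resulting separation of SQ complexities. -/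
theorem theorem1 :
    (∀ k : ℕ, 1 ≤ k → ∃ c : ℝ, 0 < c ∧ ∀ (p : ℕ) [Fact p.Prime],
      ∃ t : ℕ, 1 ≤ t ∧ (t : ℝ) ≤ c * Real.log p ∧
        ∀ ε : ℝ, 0 < ε →
          DetLearnable (k + 1) (hypClass p k) ε (ε ^ (k + 1) / t) t) ∧
    (∀ δ : ℝ, 0 ≤ δ → δ < 1 → ∃ c : ℝ, 0 < c ∧ ∀ (p : ℕ) [Fact p.Prime] (k n : ℕ),
      1 ≤ k → k + 1 ≤ n + 1 →
        ∃ t : ℝ, c * (p : ℝ) ^ ((((n + 1 : ℕ) : ℝ) - (k : ℝ)) / 4) ≤ t ∧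
          ∀ q : ℕ, RandLearnable k (hypClass p n) (1 / 2 - 2 / t) δ (1 / t) q → t ≤ q) ∧
    (∀ (k : ℕ) (ε δ : ℝ), 1 ≤ k → 0 < ε → ε < 1 / 2 → 0 ≤ δ → δ < 1 →
      ∃ c₁ c₂ : ℝ, 0 < c₁ ∧ 0 < c₂ ∧ ∀ (p : ℕ) [Fact p.Prime],
        (sqComplexity (k + 1) (hypClass p k) ε δ : ENNReal) ≤
            ENNReal.ofReal (c₁ * Real.log p) ∧
          ENNReal.ofReal (c₂ * (p : ℝ) ^ (1 / 4 : ℝ)) ≤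
            (sqComplexity k (hypClass p k) ε δ : ENNReal)) := by
  refine ⟨fun k _ => hypClass_upper_bound k, fun δ hδ hδ1 => ?_,
    fun k ε δ hk hε hε2 hδ hδ1 => ?_⟩
  · obtain ⟨c, hc, h⟩ := hypClass_lower_bound hδ hδ1
    refine ⟨c, hc, fun p hp k n hk _ => ?_⟩
    obtain ⟨t, hct, -, ht⟩ := h p k n hk
    exact ⟨t, hct, ht⟩
  · obtain ⟨c₁, hc₁, h₁⟩ := sqComplexity_hypClass_upper k hε (by linarith) δ
    obtain ⟨c₂, hc₂, h₂⟩ := sqComplexity_hypClass_lower hε2 hδ hδ1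
    exact ⟨c₁, c₂, hc₁, hc₂, fun p hp => ⟨h₁ p, h₂ p k hk⟩⟩
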